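/- **Setting.** Let $d\ge 1$, $\sigma^2>0$, $L>0$. Let $(X,Y)$ be a random pair with values in $[0,1]^d\times\mathbb R$, $\mathbb E[Y^2]<\infty$, such that $Y=m(X)+\varepsilon$ with $\mathbb E[\varepsilon\mid X]=0$ and $\mathbb V[\varepsilon\mid X]\le\sigma^2$ almost surely, $X$ uniform on $[0,1]^d$, and $m:[0,1]^d\to\mathbb R$ $L$-Lipschitz for the Euclidean norm (assumption **(H)**). Let $\mathcal D_n=((X_1,Y_1),\dots,(X_n,Y_n))$ be i.i.d. copies of $(X,Y)$. A median tree with parameters $a_n\le n$ and $k_n$ is built as follows. Draw $a_n$ of the $n$ data points uniformly without replacement. Starting from the cell $[0,1]^d$, cut every cell along a coordinate chosen uniformly and independently among the $d$ coordinates, at the empirical median (the order statistic $v_{(\ell)}$ with $F(v_{(\ell-1)})\le \frac12<F(v_{(\ell)})$, $F$ the empirical distribution function) of that coordinate over the drawn points in the cell; the point that defines the cut is not sent down to the two resulting cells. Stop when every cell has been cut $k_n$ times. The tree predicts at $x$ the average of the $Y_i$ over the drawn points in the leaf of $x$. Let $m_{\infty,n}(x)$ be the expectation of this prediction over the randomness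 of the tree (subsample and coordinates), given $\mathcal D_n$. Put $\beta=1-\frac{3}{4d}$, $C_1=\exp\big(\frac{12}{4d-3}\big)$, $$C_3=\ln\Big(\frac{-dL^2C_1\ln\beta}{2\sigma^2\ln 2}\Big),\qquad C_4=4\cdot 2^{\frac{C_3}{\ln 2-\ln\beta}},\qquad B_n(k)=2\sigma^2\frac{2^k}{n}+dL^2C_1\beta^k .$$ **Corollary (fully grown median forest).** Consider fully grown median forests, that is, $4\le a_n\le n$ and $k_n=\lfloor\log_2 a_n\rfloor-2$. 1. Under (H), for all such $n$, $a_n$: $4\le a_n2^{-k_n}<8$; almost surely every leaf of every tree contains between $3$ and $7$ data points (not counting points that define cuts); and for all $x\in[0,1]^d$, $m_{\infty,n}(x)-m(x)$ is square integrable and $$\mathbb E\big[m_{\infty,n}(x)-m(x)\big]^2\le B_n(k_n).$$ 2. For every $n\ge1$ the function $a\mapsto B_n(\log_2 a-2)$ on $(0,\infty)$ has the unique minimiser $a_n^\star=C_4\,n^{\frac{\ln 2}{\ln 2-\ln\beta}}$, and $\log_2 a_n^\star-2=\frac{1}{\ln 2-\ln\beta}\,[\ln n+C_3]$. For all sufficiently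 large $n$, $4\le\lfloor a_n^\star\rfloor$ and $\lceil a_n^\star\rceil\le n$. 3. There is a constant $C$, depending only on $d,\sigma^2,L$, such that under (H), for all $n$, if $a_n$ is $a_n^\star$ rounded down or up to an integer and $4\le a_n\le n$, then for all $x\in[0,1]^d$, $$\mathbb E\big[m_{\infty,n}(x)-m(x)\big]^2\le C\,n^{\frac{\ln\beta}{\ln 2-\ln\beta}} .$$ -/

import Mathlib

open MeasureTheory ProbabilityTheory Filter
open scoped NNReal

noncomputable section

namespace MedianForest

/-- The unit cube `[0,1]^d`, in Euclidean space. -/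
def unitCube (d : ℕ) : Set (EuclideanSpace ℝ (Fin d)) :=
  {x | ∀ j, 0 ≤ x j ∧ x j ≤ 1}

/-- A training sample of `n` observations `(X_i, Y_i)`. -/
abbrev Sample (n d : ℕ) : Type := Fin n → EuclideanSpace ℝ (Fin d) × ℝ

/-! ### The regression model -/

/-- The regression assumption, for the law `P` of the generic pair `(X, Y)` (so `X = Prod.fst`
and `Y = Prod.snd`): `Y = m(X) + ε` is square integrable, the noise `ε` is conditionally centred
given `X` (that is, `m` is the regression function), its conditional variance given `X` is at most
`σ2`, `X` is uniform on the unit cube, and `m` is `L`-Lipschitz there. -/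
structure RegressionModel (d : ℕ) (σ2 : ℝ) (L : ℝ≥0) (m : EuclideanSpace ℝ (Fin d) → ℝ)
    (P : Measure (EuclideanSpace ℝ (Fin d) × ℝ)) : Prop where
  isProbabilityMeasure : IsProbabilityMeasure P
  memLp_response : MemLp (fun z => z.2) 2 P
  uniform : P.map Prod.fst = volume.restrict (unitCube d)
  lipschitz : LipschitzOnWith L m (unitCube d)
  centred : P[fun z => z.2 - m z.1 | MeasurableSpace.comap Prod.fst inferInstance] =ᵐ[P] 0
  variance_le : Var[fun z => z.2 - m z.1; P | MeasurableSpace.comap Prod.fst inferInstance]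
    ≤ᵐ[P] fun _ => σ2

/-- The law of an i.i.d. sample of size `n`. -/
def sampleLaw {d : ℕ} (P : Measure (EuclideanSpace ℝ (Fin d) × ℝ)) (n : ℕ) :
    Measure (Sample n d) :=
  Measure.pi fun _ => P

/-! ### Median trees and forests -/

/-- The empirical distribution function at `t` of the values `(v i)_{i ∈ S}`. -/
def empiricalCDF {ι : Type*} (S : Finset ι) (v : ι → ℝ) (t : ℝ) : ℝ :=
  ((S.filter fun i => v i ≤ t).card : ℝ) / (S.card : ℝ)

/-- The empirical median of the values `(v i)_{i ∈ S}`: the least point at which the empirical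
distribution function exceeds `1/2`, which is the order statistic `v_(l)` such that
`F(v_(l-1)) ≤ 1/2 < F(v_(l))`. -/
def empiricalMedian {ι : Type*} (S : Finset ι) (v : ι → ℝ) : ℝ :=
  sInf {t | 1 / 2 < empiricalCDF S v t}

/-- A choice of one coordinate for each inner node of the complete binary tree of depth `k`: the
coordinate cut at the root, and the choices in the left and in the right subtree. -/
def SplitDirections (d : ℕ) : ℕ → Type
  | 0 => Unit
  | k + 1 => Fin d × SplitDirections d k × SplitDirections d k

instance SplitDirections.instFintype (d : ℕ) : (k : ℕ) → Fintype (SplitDirections d k)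
  | 0 => inferInstanceAs (Fintype Unit)
  | k + 1 =>
    letI := SplitDirections.instFintype d k
    inferInstanceAs (Fintype (Fin d × SplitDirections d k × SplitDirections d k))

/-- The data points in the leaf that contains `x`, in a median tree of depth `k` with the given
directions, grown from the data points with indices in `S`. A cell is cut at the empirical median,
along the chosen coordinate, of the data points it holds; the data points strictly on either side
of the cut are sent down, the point that defines the cut is not. -/
def leaf {n d : ℕ} (D : Sample n d) (x : EuclideanSpace ℝ (Fin d)) :
    (k : ℕ) → SplitDirections d k → Finset (Fin n) → Finset (Fin n)
  | 0, _, S => S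
  | k + 1, (j, left, right), S =>
    let s := empiricalMedian S fun i => (D i).1 j
    if x j ≤ s then leaf D x k left (S.filter fun i => (D i).1 j < s)
    else leaf D x k right (S.filter fun i => s < (D i).1 j)

/-- The random parameter `Θ` of a tree: the subsample of `a` of the `n` data points, drawn without
replacement, and the coordinates along which the cells are cut. -/
abbrev TreeParam (n d a k : ℕ) : Type :=
  {S : Finset (Fin n) // S.card = a} × SplitDirections d k

/-- The data points in the leaf of `x` in the tree with parameter `θ`. -/
def treeLeaf {n d a k : ℕ} (D : Sample n d) (θ : TreeParam n d a k)
    (x : EuclideanSpace ℝ (Fin d)) : Finset (Fin n) :=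
  leaf D x k θ.2 θ.1

/-- The prediction at `x` of the tree with parameter `θ`: the average response in the leaf. -/
def treeEstimate {n d a k : ℕ} (D : Sample n d) (θ : TreeParam n d a k)
    (x : EuclideanSpace ℝ (Fin d)) : ℝ :=
  (∑ i ∈ treeLeaf D θ x, (D i).2) / ((treeLeaf D θ x).card : ℝ)

/-- The infinite median forest estimate `m_{∞,n}(x)`: the expectation of the tree prediction over
`Θ`, which is uniformly distributed on its finitely many values. -/
def forestEstimate {n d : ℕ} (a k : ℕ) (D : Sample n d) (x : EuclideanSpace ℝ (Fin d)) : ℝ :=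
  (∑ θ : TreeParam n d a k, treeEstimate D θ x) / (Fintype.card (TreeParam n d a k) : ℝ)

/-- The depth of a fully grown median forest built on `a` points: `log₂ a - 2`, rounded down. -/
def fullDepth (a : ℕ) : ℕ := Nat.log 2 a - 2

/-! ### The risk bound and the constants -/

/-- `β = 1 - 3/(4d)`. -/
def beta (d : ℕ) : ℝ := 1 - 3 / (4 * (d : ℝ))

/-- `C₁ = exp (12/(4d-3))`. -/
def C1 (d : ℕ) : ℝ := Real.exp (12 / (4 * (d : ℝ) - 3))

/-- The bound `2σ² 2^k / n + d L² C₁ β^k`, as a function of a real depth `k`. -/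
def riskBound (d : ℕ) (σ2 : ℝ) (L : ℝ≥0) (n : ℕ) (k : ℝ) : ℝ :=
  2 * σ2 * ((2 : ℝ) ^ k / (n : ℝ)) + (d : ℝ) * (L : ℝ) ^ 2 * C1 d * beta d ^ k

/-- `C₃ = ln (-d L² C₁ ln β / (2σ² ln 2))`. -/
def C3 (d : ℕ) (σ2 : ℝ) (L : ℝ≥0) : ℝ :=
  Real.log (-((d : ℝ) * (L : ℝ) ^ 2 * C1 d * Real.log (beta d)) / (2 * σ2 * Real.log 2))

/-- `C₄ = 4 · 2^(C₃/(ln 2 - ln β))`. -/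
def C4 (d : ℕ) (σ2 : ℝ) (L : ℝ≥0) : ℝ :=
  4 * (2 : ℝ) ^ (C3 d σ2 L / (Real.log 2 - Real.log (beta d)))

/-- The subsample size `C₄ n^(ln 2/(ln 2 - ln β))`, before rounding. -/
def optimalSize (d : ℕ) (σ2 : ℝ) (L : ℝ≥0) (n : ℕ) : ℝ :=
  C4 d σ2 L * (n : ℝ) ^ (Real.log 2 / (Real.log 2 - Real.log (beta d)))

end MedianForest

end

/-! At a point `x` the forest is a weighted average of the responses, with weights that depend only
on the positions of the data. Splitting each response into regression function plus noise splits the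
error into a noise part and a bias; the two are uncorrelated because the noise is centred given the
positions.

Noise. Cross terms between observations vanish as well, so the second moment is at most `σ2` times
the mean sum of squared weights, hence at most `σ2` times a bound on the largest weight, as the
weights sum to one. An observation counts only in the trees that drew it, a proportion `a / n`, and
there with weight the inverse leaf size, at most `2 * 2 ^ k / a`; so no weight exceeds `2 * 2 ^ k /
n` (`weight_le`). Leaf sizes are deterministic up to rounding: a cut consumes one point, so "number
of points plus one" is additive over the two children, and it is halved.

Bias. By the Lipschitz property the squared bias is at most `L ^ 2` times the sum over directions
`j` of the mean squared side of the leaf of `x`. Fix `j` and freeze all other coordinates of the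
data. Cuts along other directions select points without looking at their `j`-th coordinates, which
stay independent and uniform. After a cut along `j`, given the median, the coordinates below and
above it are independent and uniform on the two pieces, so the situation reproduces itself
(`lintegral_cut_le`). The piece that holds `x` is at most the longer one, whose mean square is, by
Beta integrals, `1/4` of the original up to an error geometric in the remaining depth
(`choose_mul_integral_max_sq_le`). Averaged over the `d` cut directions, each level contributes the
factor `β` plus a summable error; hence `C₁ β ^ k` (`lintegral_meanSqSide_update_le`,
`sideBound_le`).

Optimisation. The bound is an increasing plus a decreasing exponential in the depth, so it has one
minimiser, where the slopes cancel (`riskBound_lt`). Rounding the size and the depth changes `2 ^ k`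
by a bounded factor only, which preserves the rate (`riskBound_fullDepth_le`). -/

namespace MedianForest

/-! ### Empirical medians -/

section Median

variable {ι : Type*} {S : Finset ι} {v : ι → ℝ}

theorem half_lt_empiricalCDF_iff (hS : S.Nonempty) (t : ℝ) :
    1 / 2 < empiricalCDF S v t ↔ S.card < 2 * (S.filter fun i => v i ≤ t).card := by
  have h : (0 : ℝ) < S.card := by exact_mod_cast hS.card_pos
  rw [empiricalCDF, lt_div_iff₀ h]
  constructor
  · intro h1
    have : (S.card : ℝ) < 2 * ((S.filter fun i => v i ≤ t).card : ℝ) := by linarith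
    exact_mod_cast this
  · intro h1
    have : (S.card : ℝ) < 2 * ((S.filter fun i => v i ≤ t).card : ℝ) := by exact_mod_cast h1
    linarith

/-- Among the data, some value is the largest not exceeding `t`. -/
theorem exists_filter_le_eq (t : ℝ) (h : (S.filter fun i => v i ≤ t).Nonempty) :
    ∃ i ∈ S, v i ≤ t ∧ (S.filter fun l => v l ≤ v i) = S.filter fun l => v l ≤ t := by
  obtain ⟨i, hi, hmax⟩ := Finset.exists_max_image _ v h
  rw [Finset.mem_filter] at hi
  refine ⟨i, hi.1, hi.2, Finset.filter_congr fun l hl => ⟨fun h1 => h1.trans hi.2, fun h1 => ?_⟩⟩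
  exact hmax l (Finset.mem_filter.2 ⟨hl, h1⟩)

/-- The number of values not exceeding `t` jumps only at data values, so the least data value that
passes the majority test is also the least real number that does. Hence the infimum defining the
median is attained, at a data point. -/
theorem exists_isLeast_half_lt (hS : S.Nonempty) :
    ∃ i ∈ S, IsLeast {t | S.card < 2 * (S.filter fun l => v l ≤ t).card} (v i) := by
  classical
  have hne : (S.filter fun i => S.card < 2 * (S.filter fun l => v l ≤ v i).card).Nonempty := by
    obtain ⟨i, hi, hmax⟩ := Finset.exists_max_image S v hS
    refine ⟨i, Finset.mem_filter.2 ⟨hi, ?_⟩⟩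
    rw [Finset.filter_true_of_mem hmax]
    have := hS.card_pos
    omega
  obtain ⟨i, hi, hmin⟩ := Finset.exists_min_image _ v hne
  rw [Finset.mem_filter] at hi
  refine ⟨i, hi.1, hi.2, fun t ht => ?_⟩
  have ht' : S.card < 2 * (S.filter fun l => v l ≤ t).card := ht
  have hne : (S.filter fun l => v l ≤ t).Nonempty := by
    rw [← Finset.card_pos]; omega
  obtain ⟨l, hl, hlt, heq⟩ := exists_filter_le_eq t hne
  exact (hmin l (Finset.mem_filter.2 ⟨hl, by rwa [heq]⟩)).trans hlt

theorem isLeast_empiricalMedian (hS : S.Nonempty) :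
    IsLeast {t | S.card < 2 * (S.filter fun l => v l ≤ t).card} (empiricalMedian S v) := by
  obtain ⟨i, -, h⟩ := exists_isLeast_half_lt (v := v) hS
  have : {t | 1 / 2 < empiricalCDF S v t}
      = {t | S.card < 2 * (S.filter fun l => v l ≤ t).card} := by
    ext t; exact half_lt_empiricalCDF_iff hS t
  rw [empiricalMedian, this, h.csInf_eq]
  exact h

theorem exists_eq_empiricalMedian (hS : S.Nonempty) : ∃ i ∈ S, empiricalMedian S v = v i := by
  obtain ⟨i, hi, h⟩ := exists_isLeast_half_lt (v := v) hS
  exact ⟨i, hi, (isLeast_empiricalMedian hS).unique h⟩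

/-- Turns comparisons with the median into counting; ties are allowed. Both the sizes of the two
sides of a cut and the measurability of the median rest on it. -/
theorem empiricalMedian_le_iff (hS : S.Nonempty) (t : ℝ) :
    empiricalMedian S v ≤ t ↔ S.card < 2 * (S.filter fun l => v l ≤ t).card := by
  have h := isLeast_empiricalMedian (v := v) hS
  refine ⟨fun h1 => lt_of_lt_of_le h.1 ?_, fun h1 => h.2 h1⟩
  exact Nat.mul_le_mul_left 2 (Finset.card_le_card
    (Finset.monotone_filter_right S fun l _ (h2 : v l ≤ _) => h2.trans h1))

-- Default value: without data the distribution function is `0 / 0 = 0`, the defining set is empty,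
-- and `sInf ∅ = 0`.
@[simp] theorem empiricalMedian_empty : empiricalMedian (∅ : Finset ι) v = 0 := by
  have h : ¬ ((2 : ℝ)⁻¹ < 0) := by norm_num
  simp [empiricalMedian, empiricalCDF, h]

/-- The largest value strictly below the median fails the majority test. -/
theorem two_mul_card_filter_lt_le :
    2 * (S.filter fun i => v i < empiricalMedian S v).card ≤ S.card := by
  rcases (S.filter fun i => v i < empiricalMedian S v).eq_empty_or_nonempty with h | h
  · simp [h]
  · obtain ⟨i, hi, hmax⟩ := Finset.exists_max_image _ v h
    rw [Finset.mem_filter] at hi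
    have hS : S.Nonempty := ⟨i, hi.1⟩
    have h1 : (S.filter fun l => v l < empiricalMedian S v) ⊆ S.filter fun l => v l ≤ v i := by
      intro l hl
      exact Finset.mem_filter.2 ⟨(Finset.mem_filter.1 hl).1, hmax l hl⟩
    have h2 := (not_congr (empiricalMedian_le_iff (v := v) hS (v i))).1 (not_le.2 hi.2)
    have := Finset.card_le_card h1
    omega

/-- At most half of the values are `<` the median, more than half are `≤` it, and for distinct
values the two counts differ by one. For an even number of points the upper of the two middle ones
is the median. -/
theorem card_filter_lt_empiricalMedian (hS : S.Nonempty) (hv : Set.InjOn v S) :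
    (S.filter fun i => v i < empiricalMedian S v).card = S.card / 2 := by
  classical
  obtain ⟨i, hi, heq⟩ := exists_eq_empiricalMedian (v := v) hS
  have h1 := two_mul_card_filter_lt_le (S := S) (v := v)
  have h2 := (empiricalMedian_le_iff (v := v) hS _).1 le_rfl
  have h3 : (S.filter fun l => v l ≤ empiricalMedian S v)
      ⊆ insert i (S.filter fun l => v l < empiricalMedian S v) := by
    intro l hl
    rw [Finset.mem_filter] at hl
    rcases hl.2.lt_or_eq with h | h
    · exact Finset.mem_insert_of_mem (Finset.mem_filter.2 ⟨hl.1, h⟩)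
    · rw [hv hl.1 hi (h.trans heq)]
      exact Finset.mem_insert_self _ _
  have h4 := (Finset.card_le_card h3).trans (Finset.card_insert_le _ _)
  omega

theorem filter_gt_empiricalMedian_eq [DecidableEq ι] {u : ι → ℝ} (hu : Set.InjOn u S) {i : ι}
    (hi : i ∈ S) (h : empiricalMedian S u = u i) :
    (S.erase i) \ (S.filter fun l => u l < empiricalMedian S u)
      = S.filter fun l => empiricalMedian S u < u l := by
  ext l
  simp only [Finset.mem_filter, Finset.mem_sdiff, Finset.mem_erase, not_and, not_lt]
  constructor
  · rintro ⟨⟨h1, h2⟩, h3⟩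
    refine ⟨h2, lt_of_le_of_ne (h3 h2) fun h4 => h1 (hu h2 hi ?_)⟩
    rw [← h, h4]
  · rintro ⟨h1, h2⟩
    refine ⟨⟨?_, h1⟩, fun _ => h2.le⟩
    rintro rfl
    rw [h] at h2
    exact lt_irrefl _ h2

theorem card_filter_gt_empiricalMedian (hS : S.Nonempty) (hv : Set.InjOn v S) :
    (S.filter fun i => empiricalMedian S v < v i).card = S.card - 1 - S.card / 2 := by
  classical
  obtain ⟨i, hi, heq⟩ := exists_eq_empiricalMedian (v := v) hS
  have h1 := card_filter_lt_empiricalMedian hS hv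
  rw [← filter_gt_empiricalMedian_eq hv hi heq, Finset.card_sdiff_of_subset, Finset.card_erase_of_mem hi, h1]
  intro l hl
  rw [Finset.mem_filter] at hl
  refine Finset.mem_erase.2 ⟨?_, hl.1⟩
  rintro rfl
  rw [heq] at hl
  exact lt_irrefl _ hl.2

theorem measurable_empiricalMedian {α : Type*} [MeasurableSpace α] (S : Finset ι)
    {v : α → ι → ℝ} (hv : ∀ i, Measurable fun z => v z i) :
    Measurable fun z => empiricalMedian S (v z) := by
  rcases S.eq_empty_or_nonempty with rfl | hS
  · simp
  · refine measurable_of_Iic fun t => ?_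
    have : (fun z => empiricalMedian S (v z)) ⁻¹' Set.Iic t
        = {z | S.card < 2 * ∑ i ∈ S, if v z i ≤ t then 1 else 0} := by
      ext z
      simp only [Set.mem_preimage, Set.mem_Iic, Set.mem_ofPred_eq]
      rw [empiricalMedian_le_iff hS, Finset.card_filter]
    rw [this]
    refine measurableSet_lt measurable_const (Measurable.const_mul ?_ 2)
    refine Finset.measurable_sum _ fun i _ => Measurable.ite ?_ measurable_const measurable_const
    exact measurableSet_le (hv i) measurable_const

end Median

/-! ### The number of data points in a leaf -/

section LeafCard

variable {n d : ℕ}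

theorem leaf_subset (D : Sample n d) (x : EuclideanSpace ℝ (Fin d)) :
    ∀ (k : ℕ) (θ : SplitDirections d k) (S : Finset (Fin n)), leaf D x k θ S ⊆ S
  | 0, _, S => Finset.Subset.refl S
  | k + 1, (j, l, r), S => by
    simp only [leaf]
    split_ifs
    · exact (leaf_subset D x k l _).trans (Finset.filter_subset _ _)
    · exact (leaf_subset D x k r _).trans (Finset.filter_subset _ _)

/-- If no two of the data points share a coordinate, a cut halves the number of data points, up to
rounding. -/
theorem card_filter_side_bounds {ι : Type*} {S : Finset ι} {v : ι → ℝ} (hv : Set.InjOn v S)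
    {c : ℕ} :
    (2 * c ≤ S.card + 1 → c ≤ (S.filter fun i => v i < empiricalMedian S v).card + 1 ∧
      c ≤ (S.filter fun i => empiricalMedian S v < v i).card + 1) ∧
    (0 < c → S.card + 1 ≤ 2 * c → (S.filter fun i => v i < empiricalMedian S v).card + 1 ≤ c ∧
      (S.filter fun i => empiricalMedian S v < v i).card + 1 ≤ c) := by
  rcases S.eq_empty_or_nonempty with rfl | hS
  · simp only [Finset.card_empty, Finset.filter_empty]
    omega
  · rw [card_filter_lt_empiricalMedian hS hv, card_filter_gt_empiricalMedian hS hv]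
    have := hS.card_pos
    omega

/-- A cut uses up one point, so the quantity `card + 1` is additive over the two children and is
halved up to rounding. Integer multiples of `2 ^ k` therefore pass down the tree without loss. -/
theorem le_card_leaf_add_one (D : Sample n d) (x : EuclideanSpace ℝ (Fin d)) (c : ℕ) :
    ∀ (k : ℕ) (θ : SplitDirections d k) (S : Finset (Fin n)),
      (∀ j, Set.InjOn (fun i => (D i).1 j) S) → c * 2 ^ k ≤ S.card + 1 →
        c ≤ (leaf D x k θ S).card + 1
  | 0, _, S, _, h => by simpa [leaf] using h
  | k + 1, (j, l, r), S, hD, h => by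
    have h' : 2 * (c * 2 ^ k) ≤ S.card + 1 := by rw [pow_succ] at h; linarith
    have hs := (card_filter_side_bounds (hD j)).1 h'
    simp only [leaf]
    split_ifs
    · exact le_card_leaf_add_one D x c k l _
        (fun j => (hD j).mono (Finset.coe_subset.2 (Finset.filter_subset _ _))) hs.1
    · exact le_card_leaf_add_one D x c k r _
        (fun j => (hD j).mono (Finset.coe_subset.2 (Finset.filter_subset _ _))) hs.2

theorem card_leaf_add_one_le (D : Sample n d) (x : EuclideanSpace ℝ (Fin d)) {c : ℕ}
    (hc : 0 < c) :
    ∀ (k : ℕ) (θ : SplitDirections d k) (S : Finset (Fin n)),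
      (∀ j, Set.InjOn (fun i => (D i).1 j) S) → S.card + 1 ≤ c * 2 ^ k →
        (leaf D x k θ S).card + 1 ≤ c
  | 0, _, S, _, h => by simpa [leaf] using h
  | k + 1, (j, l, r), S, hD, h => by
    have h' : S.card + 1 ≤ 2 * (c * 2 ^ k) := by rw [pow_succ] at h; linarith
    have hs := (card_filter_side_bounds (hD j)).2 (by positivity) h'
    simp only [leaf]
    split_ifs
    · exact card_leaf_add_one_le D x hc k l _
        (fun j => (hD j).mono (Finset.coe_subset.2 (Finset.filter_subset _ _))) hs.1
    · exact card_leaf_add_one_le D x hc k r _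
        (fun j => (hD j).mono (Finset.coe_subset.2 (Finset.filter_subset _ _))) hs.2

theorem four_mul_two_pow_fullDepth_le {a : ℕ} (ha : 4 ≤ a) : 4 * 2 ^ fullDepth a ≤ a := by
  -- `4 ≤ a` makes the truncated subtraction in `fullDepth` a true one.
  have h2 : 2 ≤ Nat.log 2 a := Nat.le_log_of_pow_le (by norm_num) (by simpa using ha)
  have h : 4 * 2 ^ fullDepth a = 2 ^ Nat.log 2 a := by
    rw [fullDepth, show (4 : ℕ) = 2 ^ 2 by norm_num, ← pow_add]
    congr 1; omega
  rw [h]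
  exact Nat.pow_log_le_self 2 (by omega)

theorem lt_eight_mul_two_pow_fullDepth {a : ℕ} (ha : 4 ≤ a) : a < 8 * 2 ^ fullDepth a := by
  have h2 : 2 ≤ Nat.log 2 a := Nat.le_log_of_pow_le (by norm_num) (by simpa using ha)
  have h : 8 * 2 ^ fullDepth a = 2 ^ (Nat.log 2 a + 1) := by
    rw [fullDepth, show (8 : ℕ) = 2 ^ 3 by norm_num, ← pow_add]
    congr 1; omega
  rw [h]
  exact Nat.lt_pow_succ_log_self (by norm_num) a

variable {a : ℕ} {D : Sample n d}

theorem card_treeLeaf_mem_Icc (hD : ∀ j, Function.Injective fun i => (D i).1 j) (ha : 4 ≤ a)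
    (θ : TreeParam n d a (fullDepth a)) (x : EuclideanSpace ℝ (Fin d)) :
    3 ≤ (treeLeaf D θ x).card ∧ (treeLeaf D θ x).card ≤ 7 := by
  -- As `4 * 2 ^ k ≤ a < 8 * 2 ^ k`, the leaf size plus one lies between `4` and `8`.
  have h1 := le_card_leaf_add_one D x 4 (fullDepth a) θ.2 θ.1 (fun j => (hD j).injOn)
    (by rw [θ.1.2]; linarith [four_mul_two_pow_fullDepth_le ha])
  have h2 := card_leaf_add_one_le D x (c := 8) (by norm_num) (fullDepth a) θ.2 θ.1
    (fun j => (hD j).injOn) (by rw [θ.1.2]; exact lt_eight_mul_two_pow_fullDepth ha)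
  rw [treeLeaf]
  omega

/-- A leaf holds at least half of the average share of the data points. -/
theorem le_two_mul_two_pow_mul_card_treeLeaf (hD : ∀ j, Function.Injective fun i => (D i).1 j)
    {k : ℕ} (ha : 4 * 2 ^ k ≤ a) (θ : TreeParam n d a k) (x : EuclideanSpace ℝ (Fin d)) :
    a ≤ 2 * 2 ^ k * (treeLeaf D θ x).card := by
  have hp : 0 < 2 ^ k := by positivity
  set c := (a + 1) / 2 ^ k with hc
  have h1 := le_card_leaf_add_one D x c k θ.2 θ.1 (fun j => (hD j).injOn)
    (by rw [θ.1.2]; exact Nat.div_mul_le_self _ _)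
  -- The leaf has at least `c - 1` points, and `c + 1 ≤ 2 * (c - 1)` once `c ≥ 3`: the factor two
  -- pays for the rounding and for the lost point.
  have h4 : 4 ≤ c := (Nat.le_div_iff_mul_le hp).2 (by omega)
  have h2 : a + 1 < (c + 1) * 2 ^ k := by
    have := Nat.lt_mul_div_succ (a + 1) hp
    rw [← hc] at this
    linarith
  have h3 : c + 1 ≤ 2 * (treeLeaf D θ x).card := by
    rw [treeLeaf]; omega
  calc a ≤ (c + 1) * 2 ^ k := by omega
    _ ≤ 2 * (treeLeaf D θ x).card * 2 ^ k := Nat.mul_le_mul_right _ h3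
    _ = _ := by ring

end LeafCard

/-! ### The sides of the cells -/

section Sides

variable {n d : ℕ}

/-- The length, in direction `j`, of the leaf that contains `x`, in a median tree of depth `k`
grown from the data points with indices in `S` and positions `X`, when the side of the root cell
in direction `j` is `[lo, hi]`. -/
noncomputable def side (X : Fin n → Fin d → ℝ) (x : Fin d → ℝ) (j : Fin d) :
    (k : ℕ) → SplitDirections d k → Finset (Fin n) → ℝ → ℝ → ℝ
  | 0, _, _, lo, hi => hi - lo
  | k + 1, (c, left, right), S, lo, hi =>
    if x c ≤ empiricalMedian S fun i => X i c then
      side X x j k left (S.filter fun i => X i c < empiricalMedian S fun i => X i c) lo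
        (if c = j then empiricalMedian S fun i => X i c else hi)
    else
      side X x j k right (S.filter fun i => (empiricalMedian S fun i => X i c) < X i c)
        (if c = j then empiricalMedian S fun i => X i c else lo) hi

/-- The mean square of `side` over uniformly distributed directions. -/
noncomputable def meanSqSide (X : Fin n → Fin d → ℝ) (x : Fin d → ℝ) (j : Fin d) :
    ℕ → Finset (Fin n) → ℝ → ℝ → ENNReal
  | 0, _, lo, hi => ENNReal.ofReal ((hi - lo) ^ 2)
  | k + 1, S, lo, hi => (d : ENNReal)⁻¹ * ∑ c,
    if x c ≤ empiricalMedian S fun i => X i c then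
      meanSqSide X x j k (S.filter fun i => X i c < empiricalMedian S fun i => X i c) lo
        (if c = j then empiricalMedian S fun i => X i c else hi)
    else
      meanSqSide X x j k (S.filter fun i => (empiricalMedian S fun i => X i c) < X i c)
        (if c = j then empiricalMedian S fun i => X i c else lo) hi

/-- The interval `[lo, hi]` keeps holding the `j`-th coordinates of `x` and of all surviving points
through every cut. -/
theorem abs_sub_le_side (D : Sample n d) (x : EuclideanSpace ℝ (Fin d)) (j : Fin d) :
    ∀ (k : ℕ) (θ : SplitDirections d k) (S : Finset (Fin n)) (lo hi : ℝ),
      lo ≤ x j → x j ≤ hi → (∀ i ∈ S, lo ≤ (D i).1 j ∧ (D i).1 j ≤ hi) →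
        ∀ i ∈ leaf D x k θ S, |(D i).1 j - x j| ≤ side (fun i => (D i).1) x j k θ S lo hi
  | 0, _, S, lo, hi, hlo, hhi, hS, i, hi' => by
    have := hS i hi'
    simp only [side]
    rw [abs_le]
    constructor <;> linarith
  | k + 1, (c, l, r), S, lo, hi, hlo, hhi, hS, i, hi' => by
    simp only [leaf] at hi'
    simp only [side]
    by_cases hx : x c ≤ empiricalMedian S fun i => (D i).1 c
    · rw [if_pos hx] at hi' ⊢
      refine abs_sub_le_side D x j k l _ _ _ hlo ?_ ?_ i hi'
      · split_ifs with h
        · rwa [← h]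
        · exact hhi
      · intro q hq
        rw [Finset.mem_filter] at hq
        refine ⟨(hS q hq.1).1, ?_⟩
        split_ifs with h
        · rw [← h]; exact hq.2.le
        · exact (hS q hq.1).2
    · rw [if_neg hx] at hi' ⊢
      refine abs_sub_le_side D x j k r _ _ _ ?_ hhi ?_ i hi'
      · split_ifs with h
        · rw [← h]; exact (not_le.1 hx).le
        · exact hlo
      · intro q hq
        rw [Finset.mem_filter] at hq
        refine ⟨?_, (hS q hq.1).2⟩
        split_ifs with h
        · rw [← h]; exact hq.2.le
        · exact (hS q hq.1).1

theorem card_splitDirections_succ (d k : ℕ) :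
    Fintype.card (SplitDirections d (k + 1))
      = d * (Fintype.card (SplitDirections d k) * Fintype.card (SplitDirections d k)) := by
  have h : Fintype.card (SplitDirections d (k + 1))
      = Fintype.card (Fin d × SplitDirections d k × SplitDirections d k) := rfl
  rw [h, Fintype.card_prod, Fintype.card_prod, Fintype.card_fin]

theorem sum_splitDirections_succ {M : Type*} [AddCommMonoid M] (d k : ℕ)
    (f : SplitDirections d (k + 1) → M) :
    ∑ θ, f θ = ∑ c : Fin d, ∑ l : SplitDirections d k, ∑ r : SplitDirections d k,
      f (c, l, r) := by
  have h : ∀ g : Fin d × SplitDirections d k × SplitDirections d k → M,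
      ∑ θ, g θ = ∑ c : Fin d, ∑ l : SplitDirections d k, ∑ r : SplitDirections d k,
        g (c, l, r) := fun g => by simp only [Fintype.sum_prod_type]
  exact h f

/-- Only the subtree that `x` enters matters; the directions of the other subtree sum out to a
factor equal to their number. This justifies the recursion for `meanSqSide`, which never mentions
trees. -/
theorem sum_side_sq (hd : 0 < d) (X : Fin n → Fin d → ℝ) (x : Fin d → ℝ) (j : Fin d) :
    ∀ (k : ℕ) (S : Finset (Fin n)) (lo hi : ℝ),
      ∑ θ, ENNReal.ofReal (side X x j k θ S lo hi ^ 2)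
        = Fintype.card (SplitDirections d k) * meanSqSide X x j k S lo hi
  | 0, S, lo, hi => by
    have h : Fintype.card (SplitDirections d 0) = 1 := rfl
    simp [side, meanSqSide, Finset.card_univ, h]
  | k + 1, S, lo, hi => by
    have hd0 : (d : ENNReal) ≠ 0 := by exact_mod_cast hd.ne'
    rw [sum_splitDirections_succ, card_splitDirections_succ, meanSqSide]
    push_cast
    rw [show ∀ A B : ENNReal, (d : ENNReal) * (A * A) * ((d : ENNReal)⁻¹ * B)
      = (d * (d : ENNReal)⁻¹) * (A * A * B) from fun A B => by ring,
      ENNReal.mul_inv_cancel hd0 (ENNReal.natCast_ne_top d), one_mul, Finset.mul_sum]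
    refine Finset.sum_congr rfl fun c _ => ?_
    simp only [side]
    split_ifs
    all_goals
      simp only [Finset.sum_const, Finset.card_univ, nsmul_eq_mul, ← Finset.mul_sum,
        sum_side_sq hd X x j k]
      ring

/-- A function of a random subset of the data points is measurable if its restrictions to the
events on which the subset is constant come from measurable functions. -/
theorem measurable_finset_dependent {α β ι : Type*} [MeasurableSpace α] [MeasurableSpace β]
    [Finite ι] {T : α → Finset ι} (hT : ∀ i, MeasurableSet {z | i ∈ T z})
    {f : α → Finset ι → β} (hf : ∀ U, Measurable fun z => f z U) :
    Measurable fun z => f z (T z) := by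
  classical
  cases nonempty_fintype ι
  have hTm : ∀ U, MeasurableSet {z | T z = U} := by
    intro U
    have : {z | T z = U} = ⋂ i, {z | i ∈ T z ↔ i ∈ U} := by
      ext z; simp [Finset.ext_iff]
    rw [this]
    refine MeasurableSet.iInter fun i => ?_
    by_cases h : i ∈ U
    · simpa [h] using hT i
    · simp only [h, iff_false]
      exact (hT i).compl
  intro s hs
  have : (fun z => f z (T z)) ⁻¹' s = ⋃ U : Finset ι, {z | T z = U} ∩ (fun z => f z U) ⁻¹' s := by
    ext z; simp
  rw [this]
  exact MeasurableSet.iUnion fun U => (hTm U).inter (hf U hs)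

/-- The term of coordinate `c` in the definition of `meanSqSide`. -/
noncomputable def cutMeanSqSide (X : Fin n → Fin d → ℝ) (x : Fin d → ℝ) (j c : Fin d) (k : ℕ)
    (S : Finset (Fin n)) (lo hi : ℝ) : ENNReal :=
  if x c ≤ empiricalMedian S fun i => X i c then
    meanSqSide X x j k (S.filter fun i => X i c < empiricalMedian S fun i => X i c) lo
      (if c = j then empiricalMedian S fun i => X i c else hi)
  else
    meanSqSide X x j k (S.filter fun i => (empiricalMedian S fun i => X i c) < X i c)
      (if c = j then empiricalMedian S fun i => X i c else lo) hi

theorem meanSqSide_succ (X : Fin n → Fin d → ℝ) (x : Fin d → ℝ) (j : Fin d) (k : ℕ)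
    (S : Finset (Fin n)) (lo hi : ℝ) : meanSqSide X x j (k + 1) S lo hi
      = (d : ENNReal)⁻¹ * ∑ c, cutMeanSqSide X x j c k S lo hi :=
  rfl

variable {α : Type*} [MeasurableSpace α]

/-- The set of points sent down is random but takes finitely many values, which
`measurable_finset_dependent` handles. The depth-`k` case is a hypothesis so that the lemma can
serve inside the recursion of `measurable_meanSqSide`. -/
theorem measurable_cutMeanSqSide_of_measurable {x : Fin d → ℝ} {j : Fin d} {k : ℕ}
    (h : ∀ (S : Finset (Fin n)) {X : α → Fin n → Fin d → ℝ} {lo hi : α → ℝ},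
      Measurable X → Measurable lo → Measurable hi →
        Measurable fun z => meanSqSide (X z) x j k S (lo z) (hi z))
    (c : Fin d) (S : Finset (Fin n)) {X : α → Fin n → Fin d → ℝ} {lo hi : α → ℝ}
    (hX : Measurable X) (hlo : Measurable lo) (hhi : Measurable hi) :
    Measurable fun z => cutMeanSqSide (X z) x j c k S (lo z) (hi z) := by
  simp only [cutMeanSqSide]
  have hXc : ∀ i, Measurable fun z => X z i c := fun i =>
    (measurable_pi_apply c).comp ((measurable_pi_apply i).comp hX)
  have hm : Measurable fun z => empiricalMedian S fun i => X z i c :=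
    measurable_empiricalMedian S hXc
  refine Measurable.ite (measurableSet_le measurable_const hm) ?_ ?_
  · refine measurable_finset_dependent
      (f := fun z U => meanSqSide (X z) x j k U (lo z)
        (if c = j then empiricalMedian S fun i => X z i c else hi z)) (fun i => ?_) fun U => ?_
    · simp only [Finset.mem_filter]
      exact (MeasurableSet.const _).inter (measurableSet_lt (hXc i) hm)
    · exact h U hX hlo (by split_ifs; exacts [hm, hhi])
  · refine measurable_finset_dependent
      (f := fun z U => meanSqSide (X z) x j k U
        (if c = j then empiricalMedian S fun i => X z i c else lo z) (hi z)) (fun i => ?_)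
        fun U => ?_
    · simp only [Finset.mem_filter]
      exact (MeasurableSet.const _).inter (measurableSet_lt hm (hXc i))
    · exact h U hX (by split_ifs; exacts [hm, hlo]) hhi

theorem measurable_meanSqSide (x : Fin d → ℝ) (j : Fin d) :
    ∀ (k : ℕ) (S : Finset (Fin n)) {X : α → Fin n → Fin d → ℝ} {lo hi : α → ℝ},
      Measurable X → Measurable lo → Measurable hi →
        Measurable fun z => meanSqSide (X z) x j k S (lo z) (hi z)
  | 0, S, X, lo, hi, hX, hlo, hhi => by
    simp only [meanSqSide]
    exact ((hhi.sub hlo).pow_const 2).ennreal_ofReal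
  | k + 1, S, X, lo, hi, hX, hlo, hhi => by
    simp only [meanSqSide_succ]
    exact Measurable.const_mul (Finset.measurable_sum _ fun c _ =>
      measurable_cutMeanSqSide_of_measurable (measurable_meanSqSide x j k) c S hX hlo hhi) _

end Sides

/-! ### Moments of the median of uniform variables -/

section Beta

open Nat in
-- Euler's Beta integral. An integration by parts, whose boundary terms vanish, moves one power from
-- `hi - s` to `s - lo`; hence induction on `r` with `t` free.
theorem integral_sub_pow_mul_sub_pow (lo hi : ℝ) (r : ℕ) : ∀ t : ℕ,
    ∫ s in lo..hi, (s - lo) ^ t * (hi - s) ^ r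
      = (t ! : ℝ) * (r ! : ℝ) / ((t + r + 1)! : ℝ) * (hi - lo) ^ (t + r + 1) := by
  induction r with
  | zero =>
    intro t
    simp only [pow_zero, mul_one, add_zero]
    rw [intervalIntegral.integral_comp_sub_right (fun s => s ^ t) lo, integral_pow,
      Nat.factorial_succ]
    have := Nat.factorial_ne_zero t
    push_cast
    field_simp
    simp
  | succ r ih =>
    intro t
    have hu : ∀ s ∈ Set.uIcc lo hi, HasDerivAt (fun s => (hi - s) ^ (r + 1))
        (-((r + 1 : ℝ) * (hi - s) ^ r)) s := fun s _ => by
      have := ((hasDerivAt_id s).const_sub hi).pow (r + 1)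
      simp only [id, Nat.add_sub_cancel] at this
      convert! this using 1
      push_cast; ring
    have hv : ∀ s ∈ Set.uIcc lo hi, HasDerivAt (fun s => (s - lo) ^ (t + 1) / (t + 1 : ℝ))
        ((s - lo) ^ t) s := fun s _ => by
      have := (((hasDerivAt_id s).sub_const lo).pow (t + 1)).div_const (t + 1 : ℝ)
      simp only [id, Nat.add_sub_cancel] at this
      convert! this using 1
      push_cast
      field_simp
    have h := intervalIntegral.integral_mul_deriv_eq_deriv_mul hu hv
      (Continuous.intervalIntegrable (by fun_prop) _ _)
      (Continuous.intervalIntegrable (by fun_prop) _ _)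
    have h' : ∫ s in lo..hi, (s - lo) ^ t * (hi - s) ^ (r + 1)
        = ∫ s in lo..hi, (hi - s) ^ (r + 1) * (s - lo) ^ t := by
      simp only [mul_comm]
    rw [h', h]
    have h'' : ∫ s in lo..hi, -((r + 1 : ℝ) * (hi - s) ^ r) * ((s - lo) ^ (t + 1) / (t + 1 : ℝ))
        = -((r + 1 : ℝ) / (t + 1)) * ∫ s in lo..hi, (s - lo) ^ (t + 1) * (hi - s) ^ r := by
      rw [← intervalIntegral.integral_const_mul]
      congr 1; ext s; ring
    rw [h'', ih (t + 1), Nat.factorial_succ t, Nat.factorial_succ r,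
      show t + 1 + r + 1 = t + (r + 1) + 1 by ring]
    have := Nat.factorial_ne_zero (t + (r + 1) + 1)
    push_cast
    simp
    field_simp

/-- Young's inequality applied to `max p q = (p + q) / 2 + |p - q| / 2`. The right-hand side is a
polynomial in `p` and `q`, so that Beta integrals apply. -/
theorem max_sq_le (p q : ℝ) {δ : ℝ} (hδ : 0 < δ) :
    (max p q) ^ 2 ≤ (1 / 4 + δ / 2) * (p + q) ^ 2
      + (1 + 1 / (2 * δ)) / 4 * (p ^ 2 - 2 * (p * q) + q ^ 2) := by
  have key : ∀ u : ℝ, ((p + q) / 2 + u / 2) ^ 2 ≤ (1 / 4 + δ / 2) * (p + q) ^ 2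
      + (1 + 1 / (2 * δ)) / 4 * u ^ 2 := by
    intro u
    have h : 0 ≤ (2 * δ * (p + q) - u) ^ 2 / (8 * δ) := by positivity
    have e : (1 / 4 + δ / 2) * (p + q) ^ 2 + (1 + 1 / (2 * δ)) / 4 * u ^ 2
        - ((p + q) / 2 + u / 2) ^ 2 = (2 * δ * (p + q) - u) ^ 2 / (8 * δ) := by
      field_simp
      ring
    linarith
  rcases le_total p q with h | h
  · rw [max_eq_right h]
    convert key (q - p) using 1 <;> ring
  · rw [max_eq_left h]
    convert key (p - q) using 1 <;> ring

/-- The mean square of the longer of the two intervals into which `[lo, hi]` is cut by the median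
of uniform variables. -/
theorem choose_mul_integral_max_sq_le {lo hi : ℝ} (h : lo ≤ hi) {t r k : ℕ} (h1 : t ≤ r + 1)
    (h2 : r ≤ t + 1) (hk : 2 ^ (k + 3) ≤ t + r + 2) :
    ((t + r + 1) * (t + r).choose t : ℕ)
      * ∫ s in lo..hi, (max (s - lo) (hi - s)) ^ 2 * ((s - lo) ^ t * (hi - s) ^ r)
      ≤ (1 / 4 + 1 / 4 * (3 / 4) ^ k) * (hi - lo) ^ 2 * (hi - lo) ^ (t + r + 1) := by
  -- The permitted excess over `1/4` is `δ`: Young's inequality spends one half of it, and the other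
  -- half must cover the spread of the median around the midpoint.
  set δ : ℝ := 1 / 4 * (3 / 4) ^ k with hδ
  have hδ0 : 0 < δ := by positivity
  have hle : ∫ s in lo..hi, (max (s - lo) (hi - s)) ^ 2 * ((s - lo) ^ t * (hi - s) ^ r)
      ≤ ∫ s in lo..hi, ((1 / 4 + δ / 2) * (hi - lo) ^ 2 * ((s - lo) ^ t * (hi - s) ^ r)
        + (1 + 1 / (2 * δ)) / 4 * ((s - lo) ^ (t + 2) * (hi - s) ^ r
          - 2 * ((s - lo) ^ (t + 1) * (hi - s) ^ (r + 1)) + (s - lo) ^ t * (hi - s) ^ (r + 2))) := by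
    refine intervalIntegral.integral_mono_on h (Continuous.intervalIntegrable (by fun_prop) _ _)
      (Continuous.intervalIntegrable (by fun_prop) _ _) fun s hs => ?_
    have hp : 0 ≤ s - lo := by linarith [hs.1]
    have hq : 0 ≤ hi - s := by linarith [hs.2]
    have := mul_le_mul_of_nonneg_right (max_sq_le (s - lo) (hi - s) hδ0)
      (show 0 ≤ (s - lo) ^ t * (hi - s) ^ r by positivity)
    refine this.trans (le_of_eq ?_)
    ring
  rw [intervalIntegral.integral_add (Continuous.intervalIntegrable (by fun_prop) _ _)
    (Continuous.intervalIntegrable (by fun_prop) _ _), intervalIntegral.integral_const_mul,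
    intervalIntegral.integral_const_mul, intervalIntegral.integral_add
    (Continuous.intervalIntegrable (by fun_prop) _ _)
    (Continuous.intervalIntegrable (by fun_prop) _ _), intervalIntegral.integral_sub
    (Continuous.intervalIntegrable (by fun_prop) _ _)
    (Continuous.intervalIntegrable (by fun_prop) _ _), intervalIntegral.integral_const_mul,
    integral_sub_pow_mul_sub_pow, integral_sub_pow_mul_sub_pow, integral_sub_pow_mul_sub_pow,
    integral_sub_pow_mul_sub_pow] at hle
  refine (mul_le_mul_of_nonneg_left hle (Nat.cast_nonneg _)).trans ?_
  -- The number of choices of the median point and of the points below it is the inverse of the Beta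
  -- integral with exponents `t` and `r`.
  have hC : ((t + r + 1) * (t + r).choose t) * (t.factorial * r.factorial)
      = (t + r + 1).factorial := by
    rw [Nat.factorial_succ, ← Nat.add_choose_mul_factorial_mul_factorial t r]
    rw [Nat.choose_symm_add]
    ring
  have hC' : (((t + r + 1) * (t + r).choose t : ℕ) : ℝ) * (t.factorial * r.factorial)
      = (t + r + 1).factorial := by exact_mod_cast hC
  generalize (((t + r + 1) * (t + r).choose t : ℕ) : ℝ) = A at *
  have e1 : t + 2 + r + 1 = t + r + 3 := by ring
  have e2 : t + 1 + (r + 1) + 1 = t + r + 3 := by ring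
  have e3 : t + (r + 2) + 1 = t + r + 3 := by ring
  rw [e1, e2, e3]
  have f3 : ((t + r + 3).factorial : ℝ) = (t + r + 3) * ((t + r + 2) * (t + r + 1).factorial) := by
    rw [show t + r + 3 = (t + r + 1) + 1 + 1 by ring, Nat.factorial_succ, Nat.factorial_succ]
    push_cast; ring
  have ft2 : ((t + 2).factorial : ℝ) = (t + 2) * ((t + 1) * t.factorial) := by
    rw [Nat.factorial_succ, Nat.factorial_succ]; push_cast; ring
  have ft1 : ((t + 1).factorial : ℝ) = (t + 1) * t.factorial := by
    rw [Nat.factorial_succ]; push_cast; ring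
  have fr2 : ((r + 2).factorial : ℝ) = (r + 2) * ((r + 1) * r.factorial) := by
    rw [Nat.factorial_succ, Nat.factorial_succ]; push_cast; ring
  have fr1 : ((r + 1).factorial : ℝ) = (r + 1) * r.factorial := by
    rw [Nat.factorial_succ]; push_cast; ring
  rw [f3, ft2, ft1, fr2, fr1, ← hC']
  have hF : ((t + r + 1).factorial : ℝ) ≠ 0 := by positivity
  have hA : A ≠ 0 := by rintro rfl; simp at hC'; exact hF hC'.symm
  have hT : (t.factorial : ℝ) ≠ 0 := by positivity
  have hR : (r.factorial : ℝ) ≠ 0 := by positivity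
  -- After normalisation, the second moment of the difference of the two pieces, relative to `hi -
  -- lo`, is `((t - r)^2 + t + r + 2) / ((t + r + 3) * (t + r + 2))`.
  have hid : A * ((1 / 4 + δ / 2) * (hi - lo) ^ 2 * (t.factorial * r.factorial
        / (A * (t.factorial * r.factorial)) * (hi - lo) ^ (t + r + 1))
      + (1 + 1 / (2 * δ)) / 4 * ((t + 2) * ((t + 1) * t.factorial) * r.factorial
          / ((t + r + 3) * ((t + r + 2) * (A * (t.factorial * r.factorial))))
          * (hi - lo) ^ (t + r + 3)
        - 2 * ((t + 1) * t.factorial * ((r + 1) * r.factorial)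
          / ((t + r + 3) * ((t + r + 2) * (A * (t.factorial * r.factorial))))
          * (hi - lo) ^ (t + r + 3))
        + t.factorial * ((r + 2) * ((r + 1) * r.factorial))
          / ((t + r + 3) * ((t + r + 2) * (A * (t.factorial * r.factorial))))
          * (hi - lo) ^ (t + r + 3)))
      = (1 / 4 + δ / 2 + (1 + 1 / (2 * δ)) / 4
          * ((((t : ℝ) - r) ^ 2 + (t + r + 2)) / ((t + r + 3) * (t + r + 2))))
        * (hi - lo) ^ 2 * (hi - lo) ^ (t + r + 1) := by
    field_simp
    ring
  rw [hid]
  have hw : 0 ≤ (hi - lo) ^ 2 * (hi - lo) ^ (t + r + 1) := by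
    have : 0 ≤ hi - lo := by linarith
    positivity
  rw [mul_assoc, mul_assoc]
  refine mul_le_mul_of_nonneg_right ?_ hw
  -- Since `|t - r| ≤ 1`, the numerator is at most `t + r + 3`, which cancels.
  have hX : (((t : ℝ) - r) ^ 2 + (t + r + 2)) / ((t + r + 3) * (t + r + 2)) ≤ 1 / 2 ^ (k + 3) := by
    have g1 : ((t : ℝ) - r) ^ 2 ≤ 1 := by
      have a1 : (t : ℝ) ≤ r + 1 := by exact_mod_cast h1
      have a2 : (r : ℝ) ≤ t + 1 := by exact_mod_cast h2
      rw [sq_le_one_iff_abs_le_one, abs_le]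
      constructor <;> linarith
    have g2 : (2 : ℝ) ^ (k + 3) ≤ t + r + 2 := by exact_mod_cast hk
    calc (((t : ℝ) - r) ^ 2 + (t + r + 2)) / ((t + r + 3) * (t + r + 2))
        ≤ (t + r + 3) / ((t + r + 3) * (t + r + 2)) :=
          div_le_div_of_nonneg_right (by linarith) (by positivity)
      _ = 1 / (t + r + 2) := by field_simp
      _ ≤ _ := by gcongr
  have hk2 : (1 / 2 : ℝ) ^ k ≤ (3 / 4) ^ k := pow_le_pow_left₀ (by norm_num) (by norm_num) k
  have hk3 : (2 / 3 : ℝ) ^ k ≤ (3 / 4) ^ k := pow_le_pow_left₀ (by norm_num) (by norm_num) k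
  have hX' := mul_le_mul_of_nonneg_left hX (show 0 ≤ (1 + 1 / (2 * δ)) / 4 by positivity)
  -- `1 / (2 * δ)` grows like `(4/3) ^ k` while the variance decays like `(1/2) ^ k`. Their product
  -- `(2/3) ^ k` is still below `(3/4) ^ k`, and `1/32 + 1/16 ≤ 1/8`, which is the half of the
  -- excess that is left.
  have hval : (1 + 1 / (2 * δ)) / 4 * (1 / 2 ^ (k + 3))
      = 1 / 32 * (1 / 2) ^ k + 1 / 16 * (2 / 3 : ℝ) ^ k := by
    have : (2 / 3 : ℝ) ^ k = (1 / 2) ^ k * (1 / (3 / 4) ^ k) := by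
      rw [one_div ((3 / 4 : ℝ) ^ k), ← inv_pow, ← mul_pow]; norm_num
    rw [this, hδ, pow_add, show (1 / 2 : ℝ) ^ k = 1 / 2 ^ k by rw [div_pow, one_pow]]
    field_simp
    ring
  rw [hval] at hX'
  have h34 : (0 : ℝ) ≤ (3 / 4) ^ k := by positivity
  linarith

end Beta

/-! ### Conditioning on one coordinate of a product measure -/

section Pi

variable {ι : Type*} [Fintype ι] [DecidableEq ι]

/-- A product measure is disintegrated over one of its coordinates. -/
theorem lintegral_pi_eq_lintegral_update_dirac {α : ι → Type*} [∀ i, MeasurableSpace (α i)]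
    (ν : ∀ i, Measure (α i)) [∀ i, SigmaFinite (ν i)] (i : ι) {f : (∀ i, α i) → ENNReal}
    (hf : Measurable f) :
    ∫⁻ u, f u ∂Measure.pi ν
      = ∫⁻ s, ∫⁻ u, f u ∂Measure.pi (Function.update ν i (Measure.dirac s)) ∂ν i := by
  have key : ∀ (μ : ∀ i, Measure (α i)) [∀ i, SigmaFinite (μ i)] (y : ∀ i, α i),
      ∫⁻ u, f u ∂Measure.pi μ
        = ∫⁻ s, (∫⋯∫⁻_Finset.univ.erase i, f ∂μ) (Function.update y i s) ∂μ i := by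
    intro μ _ y
    rw [lintegral_eq_lmarginal_univ y, lmarginal_erase f hf (Finset.mem_univ i)]
  -- Partial integrals need a base point `y`; over an empty product space all measures are zero.
  -- Integration over the coordinates other than `i` does not see the `i`-th factor, so that factor
  -- may be replaced by a Dirac mass.
  rcases isEmpty_or_nonempty (∀ i, α i) with he | ⟨⟨y⟩⟩
  · have h0 : ∀ μ : Measure (∀ i, α i), μ = 0 := fun μ => Measure.eq_zero_of_isEmpty μ
    simp only [h0, lintegral_zero_measure, lintegral_zero]
  · rw [key ν y]
    refine lintegral_congr fun s => ?_
    have : ∀ l, SigmaFinite (Function.update ν i (Measure.dirac s) l) := by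
      intro l
      rcases eq_or_ne l i with rfl | h
      · rw [Function.update_self]; infer_instance
      · rw [Function.update_of_ne h]; infer_instance
    have hm : Measurable fun s' => (∫⋯∫⁻_Finset.univ.erase i, f ∂ν) (Function.update y i s') :=
      (hf.lmarginal ν).comp (measurable_update y)
    have hcongr : (∫⋯∫⁻_Finset.univ.erase i, f ∂(Function.update ν i (Measure.dirac s)))
        = ∫⋯∫⁻_Finset.univ.erase i, f ∂ν := by
      ext z
      simp only [lmarginal]
      congr 2
      ext1 l
      rw [Function.update_of_ne (Finset.ne_of_mem_erase l.2)]
    rw [key (Function.update ν i (Measure.dirac s)) y, hcongr, Function.update_self,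
      lintegral_dirac' _ hm]

/-- Independent variables without atoms are almost surely distinct. -/
theorem ae_injective_pi (ν : ι → Measure ℝ) [∀ i, SigmaFinite (ν i)] (S : Finset ι)
    (hν : ∀ i ∈ S, NullSingletonClass (ν i)) :
    ∀ᵐ u ∂Measure.pi ν, Set.InjOn u S := by
  have h : ∀ i ∈ S, ∀ l ∈ S, i ≠ l → ∀ᵐ u ∂Measure.pi ν, u i ≠ u l := by
    intro i hi l hl hil
    have hmeas : MeasurableSet {u : ι → ℝ | u i = u l} :=
      measurableSet_eq_fun (measurable_pi_apply i) (measurable_pi_apply l)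
    rw [ae_iff]
    simp only [ne_eq, not_not]
    rw [← lintegral_indicator_one hmeas, lintegral_pi_eq_lintegral_update_dirac ν l
      (measurable_one.indicator hmeas)]
    refine (lintegral_congr fun s => ?_).trans lintegral_zero
    have : ∀ q, SigmaFinite (Function.update ν l (Measure.dirac s) q) := by
      intro q
      rcases eq_or_ne q l with rfl | h
      · rw [Function.update_self]; infer_instance
      · rw [Function.update_of_ne h]; infer_instance
    rw [lintegral_indicator_one hmeas]
    have : NullSingletonClass (Function.update ν l (Measure.dirac s) i) := by
      rw [Function.update_of_ne hil]; exact hν i hi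
    -- With `u l` frozen at `s`, a tie forces `u i = s`, which is null because the law of `u i` has
    -- no atoms.
    refine measure_mono_null (t := {u | u i = s} ∪ {u | u l ≠ s}) ?_ ?_
    · intro u hu
      by_cases hs : u l = s
      · left; exact Eq.trans hu hs
      · right; exact hs
    · rw [measure_union_null_iff]
      refine ⟨Measure.pi_hyperplane (Function.update ν l (Measure.dirac s)) i s, ?_⟩
      exact Measure.pi_eval_preimage_null (Function.update ν l (Measure.dirac s)) (i := l)
        (s := {s}ᶜ) (by rw [Function.update_self]; simp)
  have h' : ∀ᵐ u ∂Measure.pi ν, ∀ i : ι, ∀ l : ι, i ∈ S → l ∈ S → i ≠ l → u i ≠ u l := by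
    refine ae_all_iff.2 fun i => ae_all_iff.2 fun l => ?_
    by_cases hi : i ∈ S
    · by_cases hl : l ∈ S
      · by_cases hil : i = l
        · simp [hil]
        · filter_upwards [h i hi l hl hil] with u hu _ _ _ using hu
      · simp [hl]
    · simp [hi]
  filter_upwards [h'] with u hu i hi l hl hil
  by_contra hne
  exact hu i l hi hl hne hil

end Pi

/-! ### The mean square of the sides of the cells -/

section Cut

variable {ι : Type*} [DecidableEq ι]

/-- The constraint put on the variable `l` when the median of the variables in `S` is `s`, the
variables below it are those in `T`, and those above it are those in `R`. -/
def cutRegion (T R : Finset ι) (s : ℝ) (l : ι) : Set ℝ :=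
  if l ∈ T then Set.Iio s else if l ∈ R then Set.Ioi s else Set.univ

theorem mem_pi_cutRegion_iff {T R : Finset ι} (hTR : Disjoint T R) (s : ℝ) (u : ι → ℝ) :
    u ∈ Set.univ.pi (cutRegion T R s) ↔ (∀ l ∈ T, u l < s) ∧ ∀ l ∈ R, s < u l := by
  simp only [Set.mem_pi, Set.mem_univ, forall_true_left, cutRegion]
  constructor
  · intro h
    refine ⟨fun l hl => ?_, fun l hl => ?_⟩
    · have := h l
      rwa [if_pos hl] at this
    · have := h l
      rwa [if_neg (Finset.disjoint_right.1 hTR hl), if_pos hl] at this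
  · rintro ⟨h1, h2⟩ l
    split_ifs with h h'
    · exact h1 l h
    · exact h2 l h'
    · trivial

theorem measurableSet_cutRegion (T R : Finset ι) (s : ℝ) (l : ι) :
    MeasurableSet (cutRegion T R s l) := by
  unfold cutRegion
  split_ifs
  exacts [measurableSet_Iio, measurableSet_Ioi, MeasurableSet.univ]

variable [Fintype ι] {S : Finset ι} {lo hi : ℝ} {ν : ι → Measure ℝ}

/-- The total mass of the uniform measures cut at `s`. -/
theorem prod_cutRegion_mass {i : ι} (hi' : i ∈ S) {T : Finset ι} (hT : T ⊆ S.erase i)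
    (hν : ∀ l ∈ S, ν l = volume.restrict (Set.Ioo lo hi)) {s : ℝ} (hs : s ∈ Set.Ioo lo hi) :
    ∏ l, (Function.update ν i (Measure.dirac s) l).restrict
        (cutRegion T ((S.erase i) \ T) s l) Set.univ
      = ENNReal.ofReal ((s - lo) ^ T.card * (hi - s) ^ ((S.erase i) \ T).card)
        * ∏ l ∈ Sᶜ, ν l Set.univ := by
  -- The factors are `1` for the Dirac mass at `i`, `s - lo` for each index in `T`, `hi - s` for
  -- each remaining index of `S`, and the original mass outside `S`.
  rw [← Finset.prod_mul_prod_compl S, ← Finset.mul_prod_erase S _ hi', ← Finset.prod_sdiff hT]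
  have h0 : (Function.update ν i (Measure.dirac s) i).restrict
      (cutRegion T ((S.erase i) \ T) s i) Set.univ = 1 := by
    have h1 : i ∉ T := fun h => Finset.notMem_erase i S (hT h)
    have h2 : i ∉ (S.erase i) \ T := fun h => Finset.notMem_erase i S (Finset.mem_sdiff.1 h).1
    rw [cutRegion, if_neg h1, if_neg h2]
    simp
  have hR : ∏ l ∈ (S.erase i) \ T, (Function.update ν i (Measure.dirac s) l).restrict
      (cutRegion T ((S.erase i) \ T) s l) Set.univ
      = ENNReal.ofReal (hi - s) ^ ((S.erase i) \ T).card := by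
    refine Finset.prod_eq_pow_card fun l hl => ?_
    have hl' := Finset.mem_sdiff.1 hl
    rw [cutRegion, if_neg hl'.2, if_pos hl,
      Function.update_of_ne (Finset.ne_of_mem_erase hl'.1),
      hν l (Finset.mem_of_mem_erase hl'.1), Measure.restrict_restrict measurableSet_Ioi,
      Measure.restrict_apply_univ]
    have : Set.Ioi s ∩ Set.Ioo lo hi = Set.Ioo s hi := by
      ext z
      simp only [Set.mem_inter_iff, Set.mem_Ioi, Set.mem_Ioo]
      exact ⟨fun h => ⟨h.1, h.2.2⟩, fun h => ⟨h.1, hs.1.trans h.1, h.2⟩⟩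
    rw [this, Real.volume_Ioo]
  have hL : ∏ l ∈ T, (Function.update ν i (Measure.dirac s) l).restrict
      (cutRegion T ((S.erase i) \ T) s l) Set.univ
      = ENNReal.ofReal (s - lo) ^ T.card := by
    refine Finset.prod_eq_pow_card fun l hl => ?_
    have hl' := hT hl
    rw [cutRegion, if_pos hl,
      Function.update_of_ne (Finset.ne_of_mem_erase hl'),
      hν l (Finset.mem_of_mem_erase hl'), Measure.restrict_restrict measurableSet_Iio,
      Measure.restrict_apply_univ]
    have : Set.Iio s ∩ Set.Ioo lo hi = Set.Ioo lo s := by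
      ext z
      simp only [Set.mem_inter_iff, Set.mem_Iio, Set.mem_Ioo]
      exact ⟨fun h => ⟨h.2.1, h.1⟩, fun h => ⟨h.2, h.1, h.2.trans hs.2⟩⟩
    rw [this, Real.volume_Ioo]
  have hO : ∏ l ∈ Sᶜ, (Function.update ν i (Measure.dirac s) l).restrict
      (cutRegion T ((S.erase i) \ T) s l) Set.univ = ∏ l ∈ Sᶜ, ν l Set.univ := by
    refine Finset.prod_congr rfl fun l hl => ?_
    rw [Finset.mem_compl] at hl
    have h1 : l ∉ T := fun h => hl (Finset.mem_of_mem_erase (hT h))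
    have h2 : l ∉ (S.erase i) \ T :=
      fun h => hl (Finset.mem_of_mem_erase (Finset.mem_sdiff.1 h).1)
    rw [cutRegion, if_neg h1, if_neg h2, Function.update_of_ne (by rintro rfl; exact hl hi'),
      Measure.restrict_univ]
  rw [h0, hR, hL, hO, one_mul, ENNReal.ofReal_mul (pow_nonneg (by linarith [hs.1]) _),
    ENNReal.ofReal_pow (by linarith [hs.1]), ENNReal.ofReal_pow (by linarith [hs.2])]
  ring

variable {g : (ι → ℝ) → Finset ι → ℝ → ℝ → ENNReal} {κ : ℝ} {m : ℕ}

/-- The contribution to `lintegral_cut_le` of the event that the median is the variable `i`, and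
that the variables below it are those in `T`. -/
theorem lintegral_cut_event_le
    (hg : ∀ T, Measurable fun p : (ι → ℝ) × ℝ × ℝ => g p.1 T p.2.1 p.2.2)
    (hκ : 0 ≤ κ)
    (ih : ∀ (T : Finset ι) (lo hi : ℝ) (ν : ι → Measure ℝ) [∀ l, IsFiniteMeasure (ν l)],
      T ⊆ S → m ≤ T.card + 1 → lo < hi → (∀ l ∈ T, ν l = volume.restrict (Set.Ioo lo hi)) →
        ∫⁻ u, g u T lo hi ∂Measure.pi ν
          ≤ ENNReal.ofReal (κ * (hi - lo) ^ 2) * Measure.pi ν Set.univ)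
    [∀ l, IsFiniteMeasure (ν l)] (a : ℝ)
    (hν : ∀ l ∈ S, ν l = volume.restrict (Set.Ioo lo hi))
    {i : ι} (hi' : i ∈ S) {T : Finset ι} (hT : T ⊆ S.erase i) (hmT : m ≤ T.card + 1)
    (hmR : m ≤ ((S.erase i) \ T).card + 1) :
    ∫⁻ u, (if (∀ l ∈ T, u l < u i) ∧ (∀ l ∈ (S.erase i) \ T, u i < u l) then
        (if a ≤ u i then g u T lo (u i) else g u ((S.erase i) \ T) (u i) hi) else 0)
        ∂Measure.pi ν
      ≤ (∫⁻ s in Set.Ioo lo hi, ENNReal.ofReal (κ * ((max (s - lo) (hi - s)) ^ 2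
          * ((s - lo) ^ T.card * (hi - s) ^ ((S.erase i) \ T).card))))
        * ∏ l ∈ Sᶜ, ν l Set.univ := by
  set R := (S.erase i) \ T with hR
  have hTR : Disjoint T R := Finset.disjoint_sdiff
  have hH : Measurable fun p : (ι → ℝ) × ℝ => if a ≤ p.2 then g p.1 T lo p.2 else g p.1 R p.2 hi :=
    Measurable.ite (measurableSet_le measurable_const measurable_snd)
      ((hg T).comp (measurable_fst.prodMk (measurable_const.prodMk measurable_snd)))
      ((hg R).comp (measurable_fst.prodMk (measurable_snd.prodMk measurable_const)))
  have hE : MeasurableSet {p : (ι → ℝ) × ℝ | (∀ l ∈ T, p.1 l < p.2) ∧ ∀ l ∈ R, p.2 < p.1 l} := by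
    have hl : ∀ l, Measurable fun p : (ι → ℝ) × ℝ => p.1 l := fun l =>
      (measurable_pi_apply l).comp measurable_fst
    have e : {p : (ι → ℝ) × ℝ | (∀ l ∈ T, p.1 l < p.2) ∧ ∀ l ∈ R, p.2 < p.1 l}
        = (⋂ l ∈ T, {p | p.1 l < p.2}) ∩ ⋂ l ∈ R, {p | p.2 < p.1 l} := by
      ext p; simp
    rw [e]
    exact (Finset.measurableSet_biInter _ fun l _ => measurableSet_lt (hl l) measurable_snd).inter
      (Finset.measurableSet_biInter _ fun l _ => measurableSet_lt measurable_snd (hl l))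
  have hF : Measurable fun p : (ι → ℝ) × ℝ => if (∀ l ∈ T, p.1 l < p.2) ∧ (∀ l ∈ R, p.2 < p.1 l)
      then (if a ≤ p.2 then g p.1 T lo p.2 else g p.1 R p.2 hi) else 0 :=
    Measurable.ite hE hH measurable_const
  have hF' := hF.comp (measurable_id.prodMk (measurable_pi_apply i))
  simp only [Function.comp_def, id] at hF'
  rw [lintegral_pi_eq_lintegral_update_dirac ν i hF', hν i hi', ← lintegral_mul_const' _ _
    (ENNReal.prod_ne_top fun l _ => measure_ne_top _ _)]
  refine setLIntegral_mono' measurableSet_Ioo fun s hs => ?_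
  have hfin : ∀ l, IsFiniteMeasure (Function.update ν i (Measure.dirac s) l) := by
    intro l
    rcases eq_or_ne l i with rfl | h
    · rw [Function.update_self]; infer_instance
    · rw [Function.update_of_ne h]; infer_instance
  -- Under the Dirac factor the place of the cut is a constant.
  have hae : ∀ᵐ u ∂Measure.pi (Function.update ν i (Measure.dirac s)), u i = s := by
    rw [ae_iff]
    exact Measure.pi_eval_preimage_null (Function.update ν i (Measure.dirac s)) (i := i)
      (s := {s}ᶜ) (by rw [Function.update_self]; simp)
  calc ∫⁻ u, (if (∀ l ∈ T, u l < u i) ∧ (∀ l ∈ R, u i < u l) then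
        (if a ≤ u i then g u T lo (u i) else g u R (u i) hi) else 0)
        ∂Measure.pi (Function.update ν i (Measure.dirac s))
      = ∫⁻ u, (Set.univ.pi (cutRegion T R s)).indicator
          (fun u => if a ≤ s then g u T lo s else g u R s hi) u
          ∂Measure.pi (Function.update ν i (Measure.dirac s)) := by
        refine lintegral_congr_ae ?_
        filter_upwards [hae] with u hu
        classical
        rw [hu, Set.indicator_apply]
        simp only [mem_pi_cutRegion_iff hTR]
    -- The event constrains each variable separately, so the restricted measure is again a product,
    -- uniform on one of the two pieces for the indices of that piece. No conditional probability is
    -- formed: masses stay unnormalised, which is why `ih` is stated for finite measures.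
    _ = ∫⁻ u, (if a ≤ s then g u T lo s else g u R s hi) ∂Measure.pi
          (fun l => (Function.update ν i (Measure.dirac s) l).restrict (cutRegion T R s l)) := by
        rw [lintegral_indicator (MeasurableSet.univ_pi fun l => measurableSet_cutRegion T R s l),
          Measure.restrict_pi_pi]
    _ ≤ ENNReal.ofReal (κ * (max (s - lo) (hi - s)) ^ 2) * Measure.pi (fun l =>
          (Function.update ν i (Measure.dirac s) l).restrict (cutRegion T R s l)) Set.univ := by
        -- Whichever piece is followed, it is no longer than the longer one.
        split_ifs with has
        · refine (ih T lo s _ (hT.trans (Finset.erase_subset _ _)) hmT hs.1 ?_).trans ?_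
          · intro l hl
            rw [cutRegion, if_pos hl, Function.update_of_ne (Finset.ne_of_mem_erase (hT hl)),
              hν l (Finset.mem_of_mem_erase (hT hl)), Measure.restrict_restrict measurableSet_Iio]
            congr 1
            ext z
            simp only [Set.mem_inter_iff, Set.mem_Iio, Set.mem_Ioo]
            exact ⟨fun h => ⟨h.2.1, h.1⟩, fun h => ⟨h.2, h.1, h.2.trans hs.2⟩⟩
          · gcongr
            · linarith [hs.1]
            · exact le_max_left _ _
        · refine (ih R s hi _ (Finset.sdiff_subset.trans (Finset.erase_subset _ _)) hmR hs.2
            ?_).trans ?_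
          · intro l hl
            have hl' := Finset.mem_sdiff.1 hl
            rw [cutRegion, if_neg hl'.2, if_pos hl,
              Function.update_of_ne (Finset.ne_of_mem_erase hl'.1),
              hν l (Finset.mem_of_mem_erase hl'.1), Measure.restrict_restrict measurableSet_Ioi]
            congr 1
            ext z
            simp only [Set.mem_inter_iff, Set.mem_Ioi, Set.mem_Ioo]
            exact ⟨fun h => ⟨h.1, h.2.2⟩, fun h => ⟨h.1, hs.1.trans h.1, h.2⟩⟩
          · gcongr
            · linarith [hs.2]
            · exact le_max_right _ _
    _ = _ := by
        rw [Measure.pi_univ, prod_cutRegion_mass hi' hT hν hs, ← mul_assoc,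
          ← ENNReal.ofReal_mul (by positivity), mul_assoc]

end Cut

/-! ### Summing over the median point and the set of points below it -/

section CutMean

variable {ι : Type*} [Fintype ι] [DecidableEq ι] {S : Finset ι} {lo hi : ℝ} {ν : ι → Measure ℝ}
  {g : (ι → ℝ) → Finset ι → ℝ → ℝ → ENNReal} {κ : ℝ}

/-- If the mean of `g` over uniform variables is at most `κ` times the square of the length of
their interval, then the same is true, with a constant close to `κ/4`, for the value of `g` on one
side of the median, chosen in dependence of the median. -/
theorem lintegral_cut_le (k : ℕ)
    (hg : ∀ T, Measurable fun p : (ι → ℝ) × ℝ × ℝ => g p.1 T p.2.1 p.2.2)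
    (hκ : 0 ≤ κ)
    (ih : ∀ (T : Finset ι) (lo hi : ℝ) (ν : ι → Measure ℝ) [∀ l, IsFiniteMeasure (ν l)],
      T ⊆ S → 2 ^ (k + 2) ≤ T.card + 1 → lo < hi →
        (∀ l ∈ T, ν l = volume.restrict (Set.Ioo lo hi)) →
        ∫⁻ u, g u T lo hi ∂Measure.pi ν
          ≤ ENNReal.ofReal (κ * (hi - lo) ^ 2) * Measure.pi ν Set.univ)
    [∀ l, IsFiniteMeasure (ν l)] (a : ℝ) (hlohi : lo < hi)
    (hν : ∀ l ∈ S, ν l = volume.restrict (Set.Ioo lo hi)) (hS : 2 ^ (k + 3) ≤ S.card + 1) :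
    ∫⁻ u, (if a ≤ empiricalMedian S u then
        g u (S.filter fun i => u i < empiricalMedian S u) lo (empiricalMedian S u)
      else g u (S.filter fun i => empiricalMedian S u < u i) (empiricalMedian S u) hi)
        ∂Measure.pi ν
      ≤ ENNReal.ofReal ((1 / 4 + 1 / 4 * (3 / 4) ^ k) * κ * (hi - lo) ^ 2)
        * Measure.pi ν Set.univ := by
  have h8 : 8 ≤ 2 ^ (k + 3) := by
    rw [pow_add]; have : 1 ≤ 2 ^ k := Nat.one_le_two_pow; omega
  -- One cut halves `card + 1`, so the size condition of depth `k + 1` becomes that of depth `k` on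
  -- either side.
  have hkk : 2 ^ (k + 3) = 2 * 2 ^ (k + 2) := by ring
  have hSne : S.Nonempty := by rw [← Finset.card_pos]; omega
  set t := S.card / 2 with ht
  set r := S.card - 1 - S.card / 2 with hr
  set K := ∏ l ∈ Sᶜ, ν l Set.univ with hK
  set F : ι → Finset ι → (ι → ℝ) → ENNReal := fun i T u =>
    if (∀ l ∈ T, u l < u i) ∧ (∀ l ∈ (S.erase i) \ T, u i < u l) then
        (if a ≤ u i then g u T lo (u i) else g u ((S.erase i) \ T) (u i) hi) else 0 with hF
  have hFm : ∀ i T, Measurable (F i T) := by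
    intro i T
    refine Measurable.ite ?_ (Measurable.ite ?_ ?_ ?_) measurable_const
    · have e : {u : ι → ℝ | (∀ l ∈ T, u l < u i) ∧ ∀ l ∈ (S.erase i) \ T, u i < u l}
          = (⋂ l ∈ T, {u | u l < u i}) ∩ ⋂ l ∈ (S.erase i) \ T, {u | u i < u l} := by
        ext p; simp
      rw [e]
      exact (Finset.measurableSet_biInter _ fun l _ =>
        measurableSet_lt (measurable_pi_apply l) (measurable_pi_apply i)).inter
        (Finset.measurableSet_biInter _ fun l _ =>
        measurableSet_lt (measurable_pi_apply i) (measurable_pi_apply l))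
    · exact measurableSet_le measurable_const (measurable_pi_apply i)
    · exact (hg T).comp (measurable_id.prodMk
        (measurable_const.prodMk (measurable_pi_apply i)))
    · exact (hg _).comp (measurable_id.prodMk
        ((measurable_pi_apply i).prodMk measurable_const))
  -- For distinct values, the actual median index and the actual set below it give one term of the
  -- sum equal to the left-hand side; the other terms are nonnegative.
  have hcover : ∀ u : ι → ℝ, Set.InjOn u S → (if a ≤ empiricalMedian S u then
        g u (S.filter fun i => u i < empiricalMedian S u) lo (empiricalMedian S u)
      else g u (S.filter fun i => empiricalMedian S u < u i) (empiricalMedian S u) hi)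
      ≤ ∑ i ∈ S, ∑ T ∈ (S.erase i).powersetCard t, F i T u := by
    intro u hu
    obtain ⟨i, hi', heq⟩ := exists_eq_empiricalMedian (v := u) hSne
    have hR := filter_gt_empiricalMedian_eq hu hi' heq
    set T := S.filter fun i => u i < empiricalMedian S u with hT
    have hTmem : T ∈ (S.erase i).powersetCard t := by
      rw [Finset.mem_powersetCard]
      refine ⟨fun l hl => ?_, card_filter_lt_empiricalMedian hSne hu⟩
      rw [hT, Finset.mem_filter] at hl
      refine Finset.mem_erase.2 ⟨?_, hl.1⟩
      rintro rfl
      rw [heq] at hl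
      exact lt_irrefl _ hl.2
    have hval : F i T u = if a ≤ empiricalMedian S u then g u T lo (empiricalMedian S u)
        else g u (S.filter fun i => empiricalMedian S u < u i) (empiricalMedian S u) hi := by
      rw [hF]
      simp only
      rw [hR, ← heq, if_pos]
      refine ⟨fun l hl => ?_, fun l hl => ?_⟩
      · rw [hT] at hl; exact (Finset.mem_filter.1 hl).2
      · exact (Finset.mem_filter.1 hl).2
    rw [← hval]
    refine le_trans ?_ (Finset.single_le_sum (f := fun i => ∑ T ∈ (S.erase i).powersetCard t,
      F i T u) (fun _ _ => zero_le) hi')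
    exact Finset.single_le_sum (f := fun T => F i T u) (fun _ _ => zero_le) hTmem
  have hae := ae_injective_pi ν S fun l hl => by rw [hν l hl]; infer_instance
  have hmass : Measure.pi ν Set.univ = ENNReal.ofReal ((hi - lo) ^ (t + r + 1)) * K := by
    rw [Measure.pi_univ, ← Finset.prod_mul_prod_compl S, ENNReal.ofReal_pow (by linarith)]
    congr 1
    have : S.card = t + r + 1 := by omega
    rw [← this]
    refine Finset.prod_eq_pow_card fun l hl => ?_
    rw [hν l hl, Measure.restrict_apply_univ, Real.volume_Ioo]
  set q : ℝ := ∫ s in lo..hi, (max (s - lo) (hi - s)) ^ 2 * ((s - lo) ^ t * (hi - s) ^ r) with hq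
  have hint : ∫⁻ s in Set.Ioo lo hi, ENNReal.ofReal (κ * ((max (s - lo) (hi - s)) ^ 2
      * ((s - lo) ^ t * (hi - s) ^ r))) = ENNReal.ofReal (κ * q) := by
    rw [hq, ← intervalIntegral.integral_const_mul, intervalIntegral.integral_of_le hlohi.le,
      integral_Ioc_eq_integral_Ioo, ← ofReal_integral_eq_lintegral_ofReal]
    · refine (Continuous.integrableOn_Icc (a := lo) (b := hi) (by fun_prop)).mono_set
        Set.Ioo_subset_Icc_self
    · refine (ae_restrict_iff' measurableSet_Ioo).2 (Filter.Eventually.of_forall fun s hs => ?_)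
      have hp : 0 ≤ s - lo := by linarith [hs.1]
      have hq : 0 ≤ hi - s := by linarith [hs.2]
      simp only [Pi.zero_apply]
      positivity
  calc _ ≤ ∫⁻ u, ∑ i ∈ S, ∑ T ∈ (S.erase i).powersetCard t, F i T u ∂Measure.pi ν := by
        refine lintegral_mono_ae ?_
        filter_upwards [hae] with u hu using hcover u hu
    _ = ∑ i ∈ S, ∑ T ∈ (S.erase i).powersetCard t, ∫⁻ u, F i T u ∂Measure.pi ν := by
        rw [lintegral_finsetSum _ fun i _ => Finset.measurable_sum _ fun T _ => hFm i T]
        refine Finset.sum_congr rfl fun i _ => ?_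
        rw [lintegral_finsetSum _ fun T _ => hFm i T]
    _ ≤ ∑ i ∈ S, ∑ T ∈ (S.erase i).powersetCard t, ENNReal.ofReal (κ * q) * K := by
        refine Finset.sum_le_sum fun i hi' => Finset.sum_le_sum fun T hT => ?_
        rw [Finset.mem_powersetCard] at hT
        have hRc : ((S.erase i) \ T).card = r := by
          rw [Finset.card_sdiff_of_subset hT.1, Finset.card_erase_of_mem hi', hT.2]
        have := lintegral_cut_event_le (m := 2 ^ (k + 2)) hg hκ ih a hν hi' hT.1
          (by rw [hT.2]; omega) (by rw [hRc]; omega)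
        rw [hT.2, hRc, hint] at this
        exact this
    -- The bound is the same for all terms; there are `S.card = t + r + 1` choices of `i` and `(t +
    -- r).choose t` of `T`.
    _ = ((t + r + 1) * (t + r).choose t : ℕ) * (ENNReal.ofReal (κ * q) * K) := by
        have hc : ∀ i ∈ S, ∑ T ∈ (S.erase i).powersetCard t, ENNReal.ofReal (κ * q) * K
            = ((t + r).choose t : ℕ) * (ENNReal.ofReal (κ * q) * K) := by
          intro i hi'
          rw [Finset.sum_const, Finset.card_powersetCard, Finset.card_erase_of_mem hi',
            nsmul_eq_mul]
          congr 3
          omega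
        rw [Finset.sum_congr rfl hc, Finset.sum_const, nsmul_eq_mul, ← mul_assoc]
        have : S.card = t + r + 1 := by omega
        rw [this]
        push_cast
        rfl
    _ = ENNReal.ofReal (((t + r + 1) * (t + r).choose t : ℕ) * q * κ) * K := by
        rw [← mul_assoc, ← ENNReal.ofReal_natCast, ← ENNReal.ofReal_mul (Nat.cast_nonneg _)]
        congr 2
        ring
    _ ≤ ENNReal.ofReal ((1 / 4 + 1 / 4 * (3 / 4) ^ k) * (hi - lo) ^ 2
          * (hi - lo) ^ (t + r + 1) * κ) * K := by
        gcongr ENNReal.ofReal (?_ * κ) * K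
        have h1 : t ≤ r + 1 := by omega
        have h2 : r ≤ t + 1 := by omega
        exact choose_mul_integral_max_sq_le hlohi.le h1 h2 (hS.trans (by omega))
    _ = _ := by
        have : (0 : ℝ) ≤ hi - lo := by linarith
        rw [hmass, ← mul_assoc, ← ENNReal.ofReal_mul (by positivity)]
        congr 2
        ring

end CutMean

/-! ### Recursion over the depth, for one fixed direction -/

section MeanSide

variable {n d : ℕ}

/-- The bound on the mean square of a side of a cell of depth `k`. -/
noncomputable def sideBound (d k : ℕ) : ℝ :=
  ∏ l ∈ Finset.range k, (beta d + 1 / (4 * d) * (3 / 4) ^ l)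

theorem beta_pos (hd : 0 < d) : 0 < beta d := by
  have : (1 : ℝ) ≤ d := by exact_mod_cast hd
  rw [beta, sub_pos, div_lt_one (by positivity)]
  linarith

theorem sideBound_nonneg (hd : 0 < d) (k : ℕ) : 0 ≤ sideBound d k := by
  have := beta_pos hd
  exact Finset.prod_nonneg fun l _ => by positivity

/-- Each factor is `β * (1 + (3/4) ^ l / (4 * d - 3))`, because `β = (4 * d - 3) / (4 * d)`. With `1
+ y ≤ exp y` and a geometric sum at most `4`, the product is at most `exp (4 / (4 * d - 3)) * β ^
k`; the `12` in `C1` leaves room. -/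
theorem sideBound_le (hd : 0 < d) (k : ℕ) : sideBound d k ≤ C1 d * beta d ^ k := by
  have hβ := beta_pos hd
  have hd' : (1 : ℝ) ≤ d := by exact_mod_cast hd
  have hβd : beta d = (4 * d - 3) / (4 * d) := by
    rw [beta]; field_simp
  have h1 : ∀ l ∈ Finset.range k, beta d + 1 / (4 * d) * (3 / 4) ^ l
      ≤ beta d * Real.exp (1 / (4 * d - 3) * (3 / 4) ^ l) := by
    intro l _
    have := Real.add_one_le_exp (1 / (4 * (d : ℝ) - 3) * (3 / 4) ^ l)
    refine le_trans (le_of_eq ?_) (mul_le_mul_of_nonneg_left this hβ.le)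
    have : (4 * (d : ℝ) - 3) ≠ 0 := by linarith
    rw [hβd]
    field_simp
    ring
  calc sideBound d k ≤ ∏ l ∈ Finset.range k, (beta d * Real.exp (1 / (4 * d - 3) * (3 / 4) ^ l)) :=
        Finset.prod_le_prod (fun l _ => by positivity) h1
    _ = Real.exp (∑ l ∈ Finset.range k, 1 / (4 * (d : ℝ) - 3) * (3 / 4) ^ l) * beta d ^ k := by
        rw [Finset.prod_mul_distrib, Finset.prod_const, Finset.card_range, Real.exp_sum, mul_comm]
    _ ≤ C1 d * beta d ^ k := by
        rw [C1]
        gcongr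
        rw [← Finset.mul_sum, geom_sum_eq (by norm_num)]
        have h3 : ((3 / 4 : ℝ) ^ k - 1) / (3 / 4 - 1) ≤ 4 := by
          have : (0 : ℝ) ≤ (3 / 4) ^ k := by positivity
          rw [div_le_iff_of_neg (by norm_num)]
          linarith
        have h4 : 0 < 4 * (d : ℝ) - 3 := by linarith
        calc 1 / (4 * (d : ℝ) - 3) * (((3 / 4 : ℝ) ^ k - 1) / (3 / 4 - 1))
            ≤ 1 / (4 * (d : ℝ) - 3) * 4 := by gcongr
          _ ≤ 12 / (4 * d - 3) := by rw [one_div, inv_mul_eq_div]; gcongr; norm_num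

/-- One cut direction in `d` shrinks the mean square by `1/4` plus an error and the others leave it
alone, so the average factor is `β` plus `1 / d` times that error. -/
theorem sum_sideBound_eq (hd : 0 < d) (k : ℕ) (w : ℝ) (j : Fin d) :
    ∑ c : Fin d, (if c = j then (1 / 4 + 1 / 4 * (3 / 4) ^ k) * sideBound d k * w
      else sideBound d k * w) = d * (sideBound d (k + 1) * w) := by
  have hd' : (d : ℝ) ≠ 0 := by exact_mod_cast hd.ne'
  have h : ∀ c : Fin d, (if c = j then (1 / 4 + 1 / 4 * (3 / 4) ^ k) * sideBound d k * w
      else sideBound d k * w)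
      = sideBound d k * w
        + if c = j then (-3 / 4 + 1 / 4 * (3 / 4) ^ k) * sideBound d k * w else 0 := by
    intro c
    split_ifs <;> ring
  simp only [h]
  rw [Finset.sum_add_distrib, Finset.sum_const, Finset.card_univ, Fintype.card_fin,
    Finset.sum_ite_eq' Finset.univ j, if_pos (Finset.mem_univ j), nsmul_eq_mul]
  have hs : sideBound d (k + 1) = sideBound d k * (beta d + 1 / (4 * d) * (3 / 4) ^ k) :=
    Finset.prod_range_succ _ _
  rw [hs, beta]
  field_simp
  ring

/-- The core of the bias bound. `W` freezes all coordinates but the `j`-th. A cut along `c ≠ j` is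
determined by `W`, so the `j`-th coordinates of the survivors remain independent and uniform on the
same interval; a cut along `j` is `lintegral_cut_le`. Indices that have left the cell keep arbitrary
finite laws, whence the constraint on `ν` over `S` only. -/
theorem lintegral_meanSqSide_update_le (hd : 0 < d) (x : Fin d → ℝ) (j : Fin d)
    (W : Fin n → Fin d → ℝ) : ∀ (k : ℕ) (S : Finset (Fin n)) (lo hi : ℝ)
      (ν : Fin n → Measure ℝ) [∀ l, IsFiniteMeasure (ν l)],
      (∀ c, c ≠ j → Set.InjOn (fun i => W i c) S) → 2 ^ (k + 2) ≤ S.card + 1 → lo < hi →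
        (∀ l ∈ S, ν l = volume.restrict (Set.Ioo lo hi)) →
        ∫⁻ u, meanSqSide (fun i => Function.update (W i) j (u i)) x j k S lo hi ∂Measure.pi ν
          ≤ ENNReal.ofReal (sideBound d k * (hi - lo) ^ 2) * Measure.pi ν Set.univ
  | 0, S, lo, hi, ν, _, _, _, _, _ => by
    simp [meanSqSide, sideBound]
  | k + 1, S, lo, hi, ν, _, hW, hS, hlohi, hν => by
    have hd0 : (d : ENNReal) ≠ 0 := by exact_mod_cast hd.ne'
    have hX : Measurable fun (u : Fin n → ℝ) (i : Fin n) => Function.update (W i) j (u i) :=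
      measurable_pi_lambda _ fun i => (measurable_update (W i)).comp (measurable_pi_apply i)
    have hXc : ∀ (i : Fin n) (c : Fin d),
        Measurable fun u : Fin n → ℝ => Function.update (W i) j (u i) c := fun i c =>
      (measurable_pi_apply c).comp ((measurable_pi_apply i).comp hX)
    have hmeas : ∀ c : Fin d, Measurable fun u : Fin n → ℝ =>
        cutMeanSqSide (fun i => Function.update (W i) j (u i)) x j c k S lo hi := fun c =>
      measurable_cutMeanSqSide_of_measurable (measurable_meanSqSide x j k) c S hX
        measurable_const measurable_const
    simp only [meanSqSide_succ]
    rw [lintegral_const_mul _ (Finset.measurable_sum _ fun c _ => hmeas c),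
      lintegral_finsetSum _ fun c _ => hmeas c]
    have hone : ∀ c : Fin d,
        ∫⁻ u, cutMeanSqSide (fun i => Function.update (W i) j (u i)) x j c k S lo hi ∂Measure.pi ν
          ≤ ENNReal.ofReal (if c = j then
            (1 / 4 + 1 / 4 * (3 / 4) ^ k) * sideBound d k * (hi - lo) ^ 2
            else sideBound d k * (hi - lo) ^ 2) * Measure.pi ν Set.univ := fun c => by
      simp only [cutMeanSqSide]
      by_cases hc : c = j
      · subst hc
        simp only [if_true, Function.update_self]
        refine lintegral_cut_le (g := fun u T lo hi =>
          meanSqSide (fun i => Function.update (W i) c (u i)) x c k T lo hi) k (fun T => ?_)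
          (sideBound_nonneg hd k) ?_ (x c) hlohi hν hS
        · exact measurable_meanSqSide x c k T (hX.comp measurable_fst)
            (measurable_fst.comp measurable_snd) (measurable_snd.comp measurable_snd)
        · intro T lo hi ν _ hTS hT hlohi hν
          exact lintegral_meanSqSide_update_le hd x c W k T lo hi ν
            (fun b hb => (hW b hb).mono (Finset.coe_subset.2 hTS)) hT hlohi hν
      · simp only [if_neg hc, Function.update_of_ne hc]
        -- Such a cut does not shorten the side, but it does use up depth and halve the number of
        -- points.
        have hbd := (card_filter_side_bounds (S := S) (hW c hc) (c := 2 ^ (k + 2))).1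
          (by rw [← pow_succ']; exact hS)
        split_ifs
        · exact lintegral_meanSqSide_update_le hd x j W k _ lo hi ν
            (fun b hb => (hW b hb).mono (Finset.coe_subset.2 (Finset.filter_subset _ _)))
            hbd.1 hlohi fun l hl => hν l (Finset.mem_filter.1 hl).1
        · exact lintegral_meanSqSide_update_le hd x j W k _ lo hi ν
            (fun b hb => (hW b hb).mono (Finset.coe_subset.2 (Finset.filter_subset _ _)))
            hbd.2 hlohi fun l hl => hν l (Finset.mem_filter.1 hl).1
    refine (mul_le_mul_right (Finset.sum_le_sum fun c _ => hone c) _).trans (le_of_eq ?_)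
    have hnn := sideBound_nonneg hd k
    rw [← Finset.sum_mul, ← ENNReal.ofReal_sum_of_nonneg
      (fun c _ => by split_ifs <;> positivity), sum_sideBound_eq hd,
      ENNReal.ofReal_mul (Nat.cast_nonneg d), ENNReal.ofReal_natCast, ← mul_assoc, ← mul_assoc,
      ENNReal.inv_mul_cancel hd0 (ENNReal.natCast_ne_top d), one_mul]

end MeanSide

/-! ### Resampling one coordinate -/

section Resample

variable {ι : Type*} [Fintype ι] [DecidableEq ι]

/-- Replacing one coordinate by an independent copy does not change a product measure. -/
theorem measurePreserving_update {α : ι → Type*} [∀ i, MeasurableSpace (α i)]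
    (μ : ∀ i, Measure (α i)) [∀ i, IsProbabilityMeasure (μ i)] (i : ι) :
    MeasurePreserving (fun p : α i × (∀ l, α l) => Function.update p.2 i p.1)
      ((μ i).prod (Measure.pi μ)) (Measure.pi μ) := by
  have hm : Measurable fun p : α i × (∀ l, α l) => Function.update p.2 i p.1 := by
    refine measurable_pi_lambda _ fun l => ?_
    rcases eq_or_ne l i with rfl | h
    · simpa using measurable_fst
    · simp only [Function.update_of_ne h]
      exact (measurable_pi_apply l).comp measurable_snd
  refine ⟨hm, (Measure.pi_eq fun s hs => ?_).symm⟩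
  rw [Measure.map_apply hm (MeasurableSet.univ_pi hs)]
  have : (fun p : α i × (∀ l, α l) => Function.update p.2 i p.1) ⁻¹' Set.univ.pi s
      = s i ×ˢ Set.univ.pi (Function.update s i Set.univ) := by
    ext p
    simp only [Set.mem_preimage, Set.mem_pi, Set.mem_univ, forall_true_left, Set.mem_prod]
    constructor
    · intro h
      refine ⟨by simpa using h i, fun l => ?_⟩
      rcases eq_or_ne l i with rfl | hl
      · simp
      · simpa [Function.update_of_ne hl] using h l
    · rintro ⟨h1, h2⟩ l
      rcases eq_or_ne l i with rfl | hl
      · simpa using h1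
      · simpa [Function.update_of_ne hl] using h2 l
  rw [this, Measure.prod_prod, Measure.pi_pi, ← Finset.mul_prod_erase _ _ (Finset.mem_univ i),
    ← Finset.mul_prod_erase Finset.univ (fun l => μ l (s l)) (Finset.mem_univ i)]
  simp only [Function.update_self, measure_univ, one_mul]
  congr 1
  exact Finset.prod_congr rfl fun l hl => by rw [Function.update_of_ne (Finset.ne_of_mem_erase hl)]

/-- One coordinate of every vector of an i.i.d. sample, whose law is a product measure, can be
drawn independently. -/
theorem lintegral_pi_pi_eq {n : ℕ} (q : ι → Measure ℝ) [∀ c, IsProbabilityMeasure (q c)] (j : ι)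
    {F : (Fin n → ι → ℝ) → ENNReal} (hF : Measurable F) :
    ∫⁻ X, F X ∂Measure.pi (fun _ => Measure.pi q)
      = ∫⁻ W, ∫⁻ u, F (fun i => Function.update (W i) j (u i)) ∂Measure.pi (fun _ => q j)
          ∂Measure.pi (fun _ => Measure.pi q) := by
  have h1 := measurePreserving_pi (fun _ : Fin n => (q j).prod (Measure.pi q))
    (fun _ => Measure.pi q) (f := fun _ p => Function.update p.2 j p.1)
    (fun _ => measurePreserving_update q j)
  have h2 := (measurePreserving_arrowProdEquivProdArrow ℝ (ι → ℝ) (Fin n)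
    (fun _ => q j) (fun _ => Measure.pi q)).symm
  have h3 := h1.comp h2
  rw [← h3.lintegral_comp hF, lintegral_prod_symm]
  · rfl
  · exact (hF.comp h3.measurable).aemeasurable

/-- Real functions of the observations of an i.i.d. sample, whose law has no atoms, are almost
surely distinct. -/
theorem ae_injective_of_nullSingletonClass {α : Type*} [MeasurableSpace α] (μ : Measure α)
    [IsProbabilityMeasure μ] {f : α → ℝ} (hf : Measurable f) (h : NullSingletonClass (μ.map f)) :
    ∀ᵐ D ∂Measure.pi (fun _ : ι => μ), Function.Injective fun i => f (D i) := by
  have : IsProbabilityMeasure (μ.map f) := Measure.isProbabilityMeasure_map hf.aemeasurable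
  have h1 := ae_injective_pi (fun _ : ι => μ.map f) Finset.univ fun _ _ => h
  rw [← Measure.pi_map_pi (fun _ => hf.aemeasurable)] at h1
  have h2 := ae_of_ae_map (Measurable.aemeasurable (by fun_prop)) h1
  filter_upwards [h2] with D hD
  rw [Finset.coe_univ, Set.injOn_univ] at hD
  exact hD

end Resample

/-! ### The positions of the data points -/

section Positions

variable {d : ℕ} {σ2 : ℝ} {L : ℝ≥0} {m : EuclideanSpace ℝ (Fin d) → ℝ}
  {P : Measure (EuclideanSpace ℝ (Fin d) × ℝ)}

instance isProbabilityMeasure_restrict_Ioo :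
    IsProbabilityMeasure (volume.restrict (Set.Ioo (0 : ℝ) 1)) :=
  ⟨by rw [Measure.restrict_apply_univ, Real.volume_Ioo]; simp⟩

theorem measurable_position :
    Measurable fun z : EuclideanSpace ℝ (Fin d) × ℝ => (fun j => z.1 j : Fin d → ℝ) :=
  (PiLp.volume_preserving_ofLp (Fin d)).measurable.comp measurable_fst

theorem measurable_coord (j : Fin d) :
    Measurable fun z : EuclideanSpace ℝ (Fin d) × ℝ => z.1 j :=
  (measurable_pi_apply j).comp measurable_position

theorem measurableSet_unitCube : MeasurableSet (unitCube d) := by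
  have : unitCube d = ⋂ j, {x | 0 ≤ x j ∧ x j ≤ 1} := by ext x; simp [unitCube]
  rw [this]
  refine MeasurableSet.iInter fun j => ?_
  have hj : Measurable fun x : EuclideanSpace ℝ (Fin d) => x j :=
    (measurable_pi_apply j).comp (PiLp.volume_preserving_ofLp (Fin d)).measurable
  exact (measurableSet_le measurable_const hj).inter (measurableSet_le hj measurable_const)

/-- The closed and the open unit interval agree up to a null set. The open form is the convenient
one: cutting `Ioo lo hi` strictly at `s` gives exactly `Ioo lo s` and `Ioo s hi`. -/
theorem RegressionModel.map_position (h : RegressionModel d σ2 L m P) :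
    P.map (fun z => (fun j => z.1 j : Fin d → ℝ))
      = Measure.pi fun _ => volume.restrict (Set.Ioo 0 1) := by
  have h1 : (P.map Prod.fst).map (WithLp.ofLp (p := 2) (V := Fin d → ℝ))
      = P.map (fun z => (fun j => z.1 j : Fin d → ℝ)) := by
    rw [Measure.map_map (PiLp.volume_preserving_ofLp (Fin d)).measurable measurable_fst]
    rfl
  rw [← h1, h.uniform]
  have h2 : unitCube d = (WithLp.ofLp (p := 2) (V := Fin d → ℝ)) ⁻¹'
      Set.univ.pi fun _ => Set.Icc 0 1 := by
    ext x
    simp [unitCube, Pi.le_def, forall_and]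
  rw [h2, ((PiLp.volume_preserving_ofLp (Fin d)).restrict_preimage
    (MeasurableSet.univ_pi fun _ => measurableSet_Icc)).map_eq, volume_pi, Measure.restrict_pi_pi]
  congr 1
  ext1 _
  exact Measure.restrict_congr_set Ioo_ae_eq_Icc.symm

theorem RegressionModel.map_coord (h : RegressionModel d σ2 L m P) (c : Fin d) :
    P.map (fun z => z.1 c) = volume.restrict (Set.Ioo 0 1) := by
  have h1 : P.map (fun z => z.1 c)
      = (P.map (fun z => (fun j => z.1 j : Fin d → ℝ))).map (Function.eval c) := by
    rw [Measure.map_map (measurable_pi_apply c) measurable_position]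
    rfl
  rw [h1, h.map_position, (measurePreserving_eval _ c).map_eq]

theorem RegressionModel.ae_injective (h : RegressionModel d σ2 L m P) (n : ℕ) :
    ∀ᵐ D ∂sampleLaw P n, ∀ c, Function.Injective fun i => (D i).1 c := by
  have := h.isProbabilityMeasure
  refine ae_all_iff.2 fun c => ae_injective_of_nullSingletonClass P (measurable_coord c) ?_
  rw [h.map_coord c]
  infer_instance

theorem RegressionModel.ae_mem_unitCube (h : RegressionModel d σ2 L m P) :
    ∀ᵐ z ∂P, z.1 ∈ unitCube d := by
  refine ae_of_ae_map (p := fun x => x ∈ unitCube d) measurable_fst.aemeasurable ?_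
  rw [h.uniform]
  exact ae_restrict_mem measurableSet_unitCube

theorem RegressionModel.ae_forall_mem_unitCube (h : RegressionModel d σ2 L m P) (n : ℕ) :
    ∀ᵐ D ∂sampleLaw P n, ∀ i, (D i).1 ∈ unitCube d := by
  have := h.isProbabilityMeasure
  refine ae_all_iff.2 fun i => ?_
  exact (measurePreserving_eval (fun _ : Fin n => P) i).quasiMeasurePreserving.ae h.ae_mem_unitCube

/-- The mean square of a side of the leaf of `x`. -/
theorem RegressionModel.lintegral_meanSqSide_le (h : RegressionModel d σ2 L m P) (hd : 0 < d)
    {n k : ℕ} (x : Fin d → ℝ) (j : Fin d) {S : Finset (Fin n)} (hS : 2 ^ (k + 2) ≤ S.card + 1) :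
    ∫⁻ D, meanSqSide (fun i => (D i).1) x j k S 0 1 ∂sampleLaw P n
      ≤ ENNReal.ofReal (C1 d * beta d ^ k) := by
  have := h.isProbabilityMeasure
  set q : Fin d → Measure ℝ := fun _ => volume.restrict (Set.Ioo 0 1) with hq
  have hmp : MeasurePreserving (fun z : EuclideanSpace ℝ (Fin d) × ℝ => (fun j => z.1 j : Fin d → ℝ))
      P (Measure.pi q) := ⟨measurable_position, h.map_position⟩
  have hmp' := measurePreserving_pi (fun _ : Fin n => P) (fun _ => Measure.pi q) (fun _ => hmp)
  have hmeas : Measurable fun X : Fin n → Fin d → ℝ => meanSqSide X x j k S 0 1 :=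
    measurable_meanSqSide x j k S measurable_id measurable_const measurable_const
  have e1 := hmp'.lintegral_comp hmeas
  rw [sampleLaw]
  refine (le_of_eq e1).trans ?_
  rw [lintegral_pi_pi_eq q j hmeas]
  have hinj : ∀ᵐ W ∂Measure.pi (fun _ : Fin n => Measure.pi q), ∀ c : Fin d,
      Function.Injective fun i => W i c := by
    refine ae_all_iff.2 fun c => ae_injective_of_nullSingletonClass (Measure.pi q)
      (measurable_pi_apply c) ?_
    rw [show (fun w : Fin d → ℝ => w c) = Function.eval c from rfl,
      (measurePreserving_eval q c).map_eq]
    infer_instance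
  calc _ ≤ ∫⁻ _, ENNReal.ofReal (C1 d * beta d ^ k)
        ∂Measure.pi (fun _ : Fin n => Measure.pi q) := by
        refine lintegral_mono_ae ?_
        filter_upwards [hinj] with W hW
        refine (lintegral_meanSqSide_update_le hd x j W k S 0 1 (fun _ => q j)
          (fun c _ => (hW c).injOn) hS one_pos fun _ _ => rfl).trans ?_
        rw [measure_univ, mul_one]
        refine ENNReal.ofReal_le_ofReal ?_
        simpa using sideBound_le hd k
    _ = _ := by rw [lintegral_const, measure_univ, mul_one]

end Positions

/-! ### The noise -/

section Noise

variable {d : ℕ} {σ2 : ℝ} {L : ℝ≥0} {m : EuclideanSpace ℝ (Fin d) → ℝ}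
  {P : Measure (EuclideanSpace ℝ (Fin d) × ℝ)}

/-- The regression function, set to zero outside the unit cube. -/
noncomputable def cubeMean (m : EuclideanSpace ℝ (Fin d) → ℝ) : EuclideanSpace ℝ (Fin d) → ℝ :=
  (unitCube d).indicator m

/-- The noise of an observation. -/
noncomputable def noise (m : EuclideanSpace ℝ (Fin d) → ℝ)
    (z : EuclideanSpace ℝ (Fin d) × ℝ) : ℝ :=
  z.2 - cubeMean m z.1

theorem norm_sub_le_of_mem_unitCube {x y : EuclideanSpace ℝ (Fin d)} (hx : x ∈ unitCube d)
    (hy : y ∈ unitCube d) : dist x y ≤ √d := by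
  rw [EuclideanSpace.dist_eq]
  refine Real.sqrt_le_sqrt ?_
  calc ∑ j, dist (x j) (y j) ^ 2 ≤ ∑ _j : Fin d, (1 : ℝ) := by
        refine Finset.sum_le_sum fun j _ => ?_
        rw [Real.dist_eq, sq_abs, sq_le_one_iff_abs_le_one, abs_le]
        have := hx j; have := hy j
        constructor <;> linarith
    _ = d := by simp

/-- Nothing is known of `m` off the cube, so measurability comes from a Lipschitz extension that
agrees with `m` on it. -/
theorem measurable_cubeMean (hm : LipschitzOnWith L m (unitCube d)) :
    Measurable (cubeMean m) := by
  obtain ⟨m', hm', heq⟩ := hm.extend_real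
  have : cubeMean m = (unitCube d).indicator m' := by
    exact Set.indicator_congr heq
  rw [this]
  exact hm'.continuous.measurable.indicator measurableSet_unitCube

theorem exists_abs_cubeMean_le (hm : LipschitzOnWith L m (unitCube d)) :
    ∃ B, ∀ x, |cubeMean m x| ≤ B := by
  have h0 : (0 : EuclideanSpace ℝ (Fin d)) ∈ unitCube d := fun j => by simp
  refine ⟨|m 0| + L * √d, fun x => ?_⟩
  by_cases hx : x ∈ unitCube d
  · rw [cubeMean, Set.indicator_of_mem hx]
    have h1 := hm.dist_le_mul x hx 0 h0
    have h2 : (L : ℝ) * dist x 0 ≤ L * √d :=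
      mul_le_mul_of_nonneg_left (norm_sub_le_of_mem_unitCube hx h0) L.2
    rw [Real.dist_eq] at h1
    have h3 : |m x| ≤ |m 0| + |m x - m 0| := by
      calc |m x| = |m 0 + (m x - m 0)| := by congr 1; ring
        _ ≤ _ := abs_add_le _ _
    linarith
  · rw [cubeMean, Set.indicator_of_notMem hx, abs_zero]
    positivity

theorem RegressionModel.noise_ae_eq (h : RegressionModel d σ2 L m P) :
    (fun z => z.2 - m z.1) =ᵐ[P] noise m := by
  filter_upwards [h.ae_mem_unitCube] with z hz
  rw [noise, cubeMean, Set.indicator_of_mem hz]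

theorem RegressionModel.measurable_noise (h : RegressionModel d σ2 L m P) :
    Measurable (noise m) :=
  measurable_snd.sub ((measurable_cubeMean h.lipschitz).comp measurable_fst)

theorem RegressionModel.memLp_noise (h : RegressionModel d σ2 L m P) : MemLp (noise m) 2 P := by
  have := h.isProbabilityMeasure
  obtain ⟨B, hB⟩ := exists_abs_cubeMean_le h.lipschitz
  exact h.memLp_response.sub (MemLp.of_bound
    ((measurable_cubeMean h.lipschitz).comp measurable_fst).aestronglyMeasurable B
    (Filter.Eventually.of_forall fun z => by simpa using hB z.1))

theorem comap_fst_le : MeasurableSpace.comap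
    (Prod.fst : EuclideanSpace ℝ (Fin d) × ℝ → EuclideanSpace ℝ (Fin d)) inferInstance
      ≤ (inferInstance : MeasurableSpace (EuclideanSpace ℝ (Fin d) × ℝ)) :=
  measurable_iff_comap_le.1 measurable_fst

variable {f : EuclideanSpace ℝ (Fin d) → ℝ}

theorem stronglyMeasurable_comap_fst (hf : Measurable f) :
    StronglyMeasurable[MeasurableSpace.comap (Prod.fst : EuclideanSpace ℝ (Fin d) × ℝ → _)
      inferInstance] fun z => f z.1 :=
  Measurable.stronglyMeasurable (hf.comp (comap_measurable Prod.fst))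

theorem integrable_bounded_mul {Ω : Type*} [MeasurableSpace Ω] {μ : Measure Ω} {u v : Ω → ℝ}
    (hu : Measurable u) {B : ℝ} (hB : ∀ z, |u z| ≤ B) (hv : Integrable v μ) :
    Integrable (fun z => u z * v z) μ :=
  hv.bdd_mul hu.aestronglyMeasurable (Filter.Eventually.of_forall hB)

/-- A bounded function of the position comes out of the conditional expectation given the position,
and what remains is zero. -/
theorem RegressionModel.integral_mul_noise (h : RegressionModel d σ2 L m P) (hf : Measurable f)
    {B : ℝ} (hB : ∀ y, |f y| ≤ B) : ∫ z, f z.1 * noise m z ∂P = 0 := by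
  have := h.isProbabilityMeasure
  have hint : Integrable (noise m) P := h.memLp_noise.integrable (by norm_num)
  have hint' : Integrable ((fun z : EuclideanSpace ℝ (Fin d) × ℝ => f z.1) * noise m) P :=
    integrable_bounded_mul (hf.comp measurable_fst) (fun z => hB z.1) hint
  have h1 := condExp_mul_of_stronglyMeasurable_left (stronglyMeasurable_comap_fst hf) hint' hint
  have h2 := condExp_congr_ae (m := MeasurableSpace.comap Prod.fst inferInstance) h.noise_ae_eq
  have h3 : ∫ z, ((fun z : EuclideanSpace ℝ (Fin d) × ℝ => f z.1) * noise m) z ∂P = 0 := by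
    rw [← integral_condExp comap_fst_le]
    refine (integral_congr_ae ?_).trans (integral_zero _ _)
    filter_upwards [h1, h2, h.centred] with z hz1 hz2 hz3
    rw [hz1, Pi.mul_apply, ← hz2, hz3]
    simp
  exact h3

/-- As the noise is conditionally centred, its conditional variance is the conditional mean of its
square, from which `f` can be pulled out. -/
theorem RegressionModel.integral_mul_noise_sq_le (h : RegressionModel d σ2 L m P)
    (hf : Measurable f) {B : ℝ} (hB : ∀ y, |f y| ≤ B) (hf0 : ∀ y, 0 ≤ f y) :
    ∫ z, f z.1 * noise m z ^ 2 ∂P ≤ σ2 * ∫ z, f z.1 ∂P := by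
  have := h.isProbabilityMeasure
  have hint : Integrable (noise m ^ 2) P := h.memLp_noise.integrable_sq
  have hint' : Integrable ((fun z : EuclideanSpace ℝ (Fin d) × ℝ => f z.1) * (noise m ^ 2)) P :=
    integrable_bounded_mul (hf.comp measurable_fst) (fun z => hB z.1) hint
  have h1 := condExp_mul_of_stronglyMeasurable_left (stronglyMeasurable_comap_fst hf) hint' hint
  have h2 := condExp_congr_ae (m := MeasurableSpace.comap Prod.fst inferInstance) h.noise_ae_eq
  have h3 := condVar_congr_ae (m := MeasurableSpace.comap Prod.fst inferInstance) h.noise_ae_eq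
  have h4 := condVar_ae_eq_condExp_sq_sub_sq_condExp comap_fst_le h.memLp_noise
  have hfint : Integrable (fun z : EuclideanSpace ℝ (Fin d) × ℝ => f z.1) P :=
    Integrable.of_bound (hf.comp measurable_fst).aestronglyMeasurable B
      (Filter.Eventually.of_forall fun z => hB z.1)
  have h5 : ∫ z, ((fun z : EuclideanSpace ℝ (Fin d) × ℝ => f z.1) * (noise m ^ 2)) z ∂P ≤ ∫ z, σ2 * f z.1 ∂P := by
    rw [← integral_condExp comap_fst_le]
    refine integral_mono_ae integrable_condExp (hfint.const_mul _) ?_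
    filter_upwards [h1, h2, h3, h4, h.centred, h.variance_le] with z hz1 hz2 hz3 hz4 hz5 hz6
    rw [hz1, Pi.mul_apply, mul_comm]
    refine mul_le_mul_of_nonneg_right ?_ (hf0 _)
    rw [Pi.sub_apply, Pi.pow_apply, ← hz2, hz5] at hz4
    simp only [Pi.zero_apply] at hz4
    rw [hz3, hz4] at hz6
    linarith
  rw [integral_const_mul] at h5
  exact h5

variable {n : ℕ}

theorem measurable_positions :
    Measurable fun D : Sample n d => fun l => (D l).1 :=
  measurable_pi_lambda _ fun l => measurable_fst.comp (measurable_pi_apply l)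

theorem positions_update (D : Sample n d) (i : Fin n) (z : EuclideanSpace ℝ (Fin d) × ℝ) :
    (fun l => (Function.update D i z l).1) = Function.update (fun l => (D l).1) i z.1 := by
  ext1 l
  rcases eq_or_ne l i with rfl | hl
  · simp
  · simp [Function.update_of_ne hl]

variable {H : (Fin n → EuclideanSpace ℝ (Fin d)) → ℝ}

/-- Resample observation `i` with the others held fixed: `A` is then constant and `H` is a bounded
function of the new position, so `integral_mul_noise` applies. `A` may be unbounded, in particular
another observation's noise, hence the integrability hypothesis. -/
theorem RegressionModel.integral_mul_noise_eq_zero (h : RegressionModel d σ2 L m P) (i : Fin n)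
    (hH : Measurable H) {B : ℝ} (hB : ∀ y, |H y| ≤ B) {A : Sample n d → ℝ}
    (hA : ∀ D z, A (Function.update D i z) = A D)
    (hint : Integrable (fun D => H (fun l => (D l).1) * A D * noise m (D i)) (sampleLaw P n)) :
    ∫ D, H (fun l => (D l).1) * A D * noise m (D i) ∂sampleLaw P n = 0 := by
  have := h.isProbabilityMeasure
  have hmp := measurePreserving_update (fun _ : Fin n => P) i
  rw [sampleLaw] at hint ⊢
  rw [← hmp.map_eq] at hint ⊢
  rw [integral_map hmp.measurable.aemeasurable hint.aestronglyMeasurable]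
  have hint' := (integrable_map_measure hint.aestronglyMeasurable hmp.measurable.aemeasurable).1 hint
  simp only [Function.comp_def] at hint'
  rw [integral_prod_symm _ hint']
  refine (integral_congr_ae (Filter.Eventually.of_forall fun D => ?_)).trans (integral_zero _ _)
  simp only [positions_update, hA, Function.update_self]
  have := h.integral_mul_noise
    (hH.comp (measurable_update (fun l => (D l).1) (a := i))) (fun y => hB _)
  simp only [Function.comp_apply] at this
  calc _ = ∫ z, A D * (H (Function.update (fun l => (D l).1) i z.1) * noise m z) ∂P := by
        congr 1; ext z; ring
    _ = 0 := by rw [integral_const_mul, this, mul_zero]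

theorem RegressionModel.integral_mul_noise_sq_sample_le (h : RegressionModel d σ2 L m P)
    (i : Fin n) (hH : Measurable H) {B : ℝ} (hB : ∀ y, |H y| ≤ B) (hH0 : ∀ y, 0 ≤ H y) :
    ∫ D, H (fun l => (D l).1) * noise m (D i) ^ 2 ∂sampleLaw P n
      ≤ σ2 * ∫ D, H (fun l => (D l).1) ∂sampleLaw P n := by
  have := h.isProbabilityMeasure
  have hmp := measurePreserving_update (fun _ : Fin n => P) i
  have hsq : Integrable (fun D : Sample n d => noise m (D i) ^ 2) (sampleLaw P n) :=
    ((measurePreserving_eval (fun _ : Fin n => P) i).integrable_comp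
      (h.measurable_noise.pow_const 2).aestronglyMeasurable).2 h.memLp_noise.integrable_sq
  have hint : Integrable (fun D : Sample n d => H (fun l => (D l).1) * noise m (D i) ^ 2)
      (sampleLaw P n) := integrable_bounded_mul (hH.comp measurable_positions) (fun _ => hB _) hsq
  have hint2 : Integrable (fun D : Sample n d => H (fun l => (D l).1)) (sampleLaw P n) := by
    have : IsProbabilityMeasure (sampleLaw P n) := by rw [sampleLaw]; infer_instance
    exact Integrable.of_bound (hH.comp measurable_positions).aestronglyMeasurable B
      (Filter.Eventually.of_forall fun _ => hB _)
  rw [sampleLaw] at hint hint2 ⊢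
  rw [← hmp.map_eq] at hint hint2 ⊢
  rw [integral_map hmp.measurable.aemeasurable hint.aestronglyMeasurable,
    integral_map hmp.measurable.aemeasurable hint2.aestronglyMeasurable]
  have hint' := (integrable_map_measure hint.aestronglyMeasurable hmp.measurable.aemeasurable).1 hint
  have hint2' :=
    (integrable_map_measure hint2.aestronglyMeasurable hmp.measurable.aemeasurable).1 hint2
  simp only [Function.comp_def] at hint' hint2'
  rw [integral_prod_symm _ hint', integral_prod_symm _ hint2', ← integral_const_mul]
  refine integral_mono hint'.integral_prod_right (hint2'.integral_prod_right.const_mul _)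
    fun D => ?_
  simp only [positions_update, Function.update_self]
  exact h.integral_mul_noise_sq_le
    (hH.comp (measurable_update (fun l => (D l).1) (a := i))) (fun y => hB _) (fun y => hH0 _)

end Noise

/-! ### The weights of the observations -/

section Weight

variable {n d a k : ℕ}

theorem leaf_congr {D D' : Sample n d} (h : ∀ i, (D i).1 = (D' i).1)
    (x : EuclideanSpace ℝ (Fin d)) :
    ∀ (k : ℕ) (θ : SplitDirections d k) (S : Finset (Fin n)), leaf D x k θ S = leaf D' x k θ S
  | 0, _, _ => rfl
  | k + 1, (j, l, r), S => by
    simp only [leaf, h, leaf_congr h x k]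

theorem measurableSet_mem_leaf {α : Type*} [MeasurableSpace α] {D : α → Sample n d}
    (hD : ∀ i j, Measurable fun z => (D z i).1 j) (x : EuclideanSpace ℝ (Fin d)) (i : Fin n) :
    ∀ (k : ℕ) (θ : SplitDirections d k) (S : Finset (Fin n)),
      MeasurableSet {z | i ∈ leaf (D z) x k θ S}
  | 0, _, S => by
    simp only [leaf]
    exact MeasurableSet.const _
  | k + 1, (j, l, r), S => by
    have hm : Measurable fun z => empiricalMedian S fun i => (D z i).1 j :=
      measurable_empiricalMedian S fun i => hD i j
    have h1 : Measurable fun z =>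
        i ∈ leaf (D z) x k l (S.filter fun i => (D z i).1 j
          < empiricalMedian S fun i => (D z i).1 j) := by
      refine measurable_finset_dependent (f := fun z U => i ∈ leaf (D z) x k l U) (fun q => ?_)
        fun U => measurableSet_setOfPred.1 (measurableSet_mem_leaf hD x i k l U)
      simp only [Finset.mem_filter]
      exact (MeasurableSet.const _).inter (measurableSet_lt (hD q j) hm)
    have h2 : Measurable fun z =>
        i ∈ leaf (D z) x k r (S.filter fun i => (empiricalMedian S fun i => (D z i).1 j)
          < (D z i).1 j) := by
      refine measurable_finset_dependent (f := fun z U => i ∈ leaf (D z) x k r U) (fun q => ?_)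
        fun U => measurableSet_setOfPred.1 (measurableSet_mem_leaf hD x i k r U)
      simp only [Finset.mem_filter]
      exact (MeasurableSet.const _).inter (measurableSet_lt hm (hD q j))
    have h3 : MeasurableSet {z | x j ≤ empiricalMedian S fun i => (D z i).1 j} :=
      measurableSet_le measurable_const hm
    have e : {z | i ∈ leaf (D z) x (k + 1) (j, l, r) S}
        = ({z | x j ≤ empiricalMedian S fun i => (D z i).1 j} ∩
          {z | i ∈ leaf (D z) x k l (S.filter fun i => (D z i).1 j
            < empiricalMedian S fun i => (D z i).1 j)}) ∪
          ({z | x j ≤ empiricalMedian S fun i => (D z i).1 j}ᶜ ∩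
          {z | i ∈ leaf (D z) x k r (S.filter fun i => (empiricalMedian S fun i => (D z i).1 j)
            < (D z i).1 j)}) := by
      ext z
      by_cases hz : x j ≤ empiricalMedian S fun i => (D z i).1 j <;> simp [leaf, hz]
    rw [e]
    exact (h3.inter (measurableSet_setOfPred.2 h1)).union (h3.compl.inter (measurableSet_setOfPred.2 h2))

/-- The weight of the response of the observation `i` in the forest estimate at `x`. -/
noncomputable def weight (a k : ℕ) (x : EuclideanSpace ℝ (Fin d)) (i : Fin n)
    (D : Sample n d) : ℝ :=
  (∑ θ : TreeParam n d a k,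
    if i ∈ treeLeaf D θ x then ((treeLeaf D θ x).card : ℝ)⁻¹ else 0)
    / (Fintype.card (TreeParam n d a k) : ℝ)

/-- The weights depend on the positions of the observations only. -/
theorem weight_eq_positions (x : EuclideanSpace ℝ (Fin d)) (i : Fin n) (D : Sample n d) :
    weight a k x i D = weight a k x i fun l => ((D l).1, 0) := by
  have h : ∀ θ : TreeParam n d a k, treeLeaf D θ x = treeLeaf (fun l => ((D l).1, 0)) θ x :=
    fun θ => leaf_congr (D := D) (D' := fun l => ((D l).1, 0)) (fun _ => rfl) x k θ.2 θ.1.1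
  simp only [weight, h]

theorem measurable_weight (x : EuclideanSpace ℝ (Fin d)) (i : Fin n) :
    Measurable fun X : Fin n → EuclideanSpace ℝ (Fin d) =>
      weight a k x i fun l => (X l, 0) := by
  refine (Finset.measurable_sum _ fun θ _ => ?_).div_const _
  refine measurable_finset_dependent
    (f := fun _ U => if i ∈ U then (U.card : ℝ)⁻¹ else 0) (fun q => ?_) fun U => measurable_const
  exact measurableSet_mem_leaf (D := fun (X : Fin n → EuclideanSpace ℝ (Fin d)) l => (X l, 0))
    (fun l j => ((measurable_pi_apply j).comp
      (PiLp.volume_preserving_ofLp (Fin d)).measurable).comp (measurable_pi_apply l)) x q k θ.2 θ.1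

theorem weight_nonneg (x : EuclideanSpace ℝ (Fin d)) (i : Fin n) (D : Sample n d) :
    0 ≤ weight a k x i D := by
  unfold weight
  positivity

theorem forestEstimate_eq_sum_weight (x : EuclideanSpace ℝ (Fin d)) (D : Sample n d) :
    forestEstimate a k D x = ∑ i, weight a k x i D * (D i).2 := by
  have h : ∀ θ : TreeParam n d a k, treeEstimate D θ x
      = ∑ i, (if i ∈ treeLeaf D θ x then ((treeLeaf D θ x).card : ℝ)⁻¹ else 0) * (D i).2 := by
    intro θ
    simp only [treeEstimate, ite_mul, zero_mul, Finset.sum_ite_mem, Finset.univ_inter]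
    rw [← Finset.mul_sum, div_eq_inv_mul]
  simp only [forestEstimate, weight, h]
  rw [Finset.sum_comm, Finset.sum_div]
  refine Finset.sum_congr rfl fun i _ => ?_
  rw [← Finset.sum_mul]
  ring

theorem card_treeParam_pos (hd : 0 < d) (han : a ≤ n) :
    0 < Fintype.card (TreeParam n d a k) := by
  have h1 : Nonempty {S : Finset (Fin n) // S.card = a} := by
    obtain ⟨S, -, hS⟩ := Finset.exists_subset_card_eq (s := (Finset.univ : Finset (Fin n))) (n := a)
      (by simpa using han)
    exact ⟨S, hS⟩
  have h2 : ∀ k, Nonempty (SplitDirections d k) := by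
    intro k
    induction k with
    | zero => exact ⟨()⟩
    | succ k ih =>
      obtain ⟨θ⟩ := ih
      exact ⟨(⟨0, hd⟩, θ, θ)⟩
  have := h2 k
  exact Fintype.card_pos

theorem sum_inv_card_treeLeaf (x : EuclideanSpace ℝ (Fin d)) (D : Sample n d)
    (θ : TreeParam n d a k) (h : (treeLeaf D θ x).Nonempty) :
    ∑ i, (if i ∈ treeLeaf D θ x then ((treeLeaf D θ x).card : ℝ)⁻¹ else 0) = 1 := by
  rw [Finset.sum_ite_mem, Finset.univ_inter, Finset.sum_const, nsmul_eq_mul]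
  have := h.card_pos
  field_simp

theorem sum_weight (hd : 0 < d) (han : a ≤ n) (x : EuclideanSpace ℝ (Fin d)) {D : Sample n d}
    (h : ∀ θ : TreeParam n d a k, (treeLeaf D θ x).Nonempty) :
    ∑ i, weight a k x i D = 1 := by
  have hc := card_treeParam_pos (k := k) hd han
  simp only [weight]
  rw [← Finset.sum_div, Finset.sum_comm]
  simp only [sum_inv_card_treeLeaf x D _ (h _)]
  rw [Finset.sum_const, Finset.card_univ, nsmul_eq_mul, mul_one]
  field_simp

theorem abs_weight_le_one (x : EuclideanSpace ℝ (Fin d)) (i : Fin n) (D : Sample n d) :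
    |weight a k x i D| ≤ 1 := by
  rw [abs_of_nonneg (weight_nonneg x i D), weight]
  refine div_le_one_of_le₀ ?_ (Nat.cast_nonneg _)
  calc _ ≤ ∑ _θ : TreeParam n d a k, (1 : ℝ) := by
        refine Finset.sum_le_sum fun θ _ => ?_
        split_ifs with h
        · have : 1 ≤ (treeLeaf D θ x).card := Finset.card_pos.2 ⟨i, h⟩
          exact inv_le_one_of_one_le₀ (by exact_mod_cast this)
        · exact zero_le_one
    _ = _ := by simp

/-- Every observation is drawn with probability `a / n`. -/
theorem card_mul_sum_mem_eq (i : Fin n) :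
    (n : ℝ) * ∑ S : {S : Finset (Fin n) // S.card = a}, (if i ∈ S.1 then (1 : ℝ) else 0)
      = a * Fintype.card {S : Finset (Fin n) // S.card = a} := by
  classical
  have h1 : ∀ i, ∑ S : {S : Finset (Fin n) // S.card = a}, (if i ∈ S.1 then (1 : ℝ) else 0)
      = ∑ S ∈ Finset.univ.powersetCard a, (if i ∈ S then (1 : ℝ) else 0) := by
    intro i
    exact (Finset.sum_subtype (Finset.univ.powersetCard a) (p := fun S => S.card = a)
      (fun S => by simp [Finset.mem_powersetCard]) fun S => if i ∈ S then (1 : ℝ) else 0).symm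
  -- Transposing `i` and `l` permutes the subsets of size `a`, so the count is the same for every
  -- index; double counting in `h2` then gives the total.
  have hperm : ∀ i l : Fin n, ∑ S ∈ Finset.univ.powersetCard a, (if i ∈ S then (1 : ℝ) else 0)
      = ∑ S ∈ Finset.univ.powersetCard a, (if l ∈ S then (1 : ℝ) else 0) := by
    intro i l
    refine Finset.sum_nbij' (fun S => S.map (Equiv.swap i l).toEmbedding)
      (fun S => S.map (Equiv.swap i l).toEmbedding) ?_ ?_ ?_ ?_ ?_
    · intro S hS; simpa [Finset.mem_powersetCard] using hS
    · intro S hS; simpa [Finset.mem_powersetCard] using hS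
    · intro S _; ext q; simp
    · intro S _; ext q; simp
    · intro S _; simp
  have h2 : ∑ l : Fin n, ∑ S ∈ Finset.univ.powersetCard a, (if l ∈ S then (1 : ℝ) else 0)
      = a * Fintype.card {S : Finset (Fin n) // S.card = a} := by
    rw [Finset.sum_comm]
    have : ∀ S ∈ (Finset.univ : Finset (Fin n)).powersetCard a,
        ∑ l : Fin n, (if l ∈ S then (1 : ℝ) else 0) = a := by
      intro S hS
      rw [Finset.sum_ite_mem, Finset.univ_inter, Finset.sum_const,
        (Finset.mem_powersetCard.1 hS).2]
      simp
    rw [Finset.sum_congr rfl this, Finset.sum_const, Finset.card_powersetCard,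
      Fintype.card_finset_len, Finset.card_univ, nsmul_eq_mul, mul_comm]
  rw [h1, ← h2, Finset.sum_congr rfl fun l _ => hperm l i]
  simp

/-- An index must be drawn to receive weight, which has probability `a / n`, and a leaf then gives
it at most `2 * 2 ^ k / a`. The subsample size cancels, so averaging over subsamples puts `n`, not
`a`, in the variance. -/
theorem weight_le (hd : 0 < d) (ha : 0 < a) (han : a ≤ n) (x : EuclideanSpace ℝ (Fin d))
    (i : Fin n) {D : Sample n d} (h : ∀ θ : TreeParam n d a k, a ≤ 2 * 2 ^ k * (treeLeaf D θ x).card) :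
    weight a k x i D ≤ 2 * (2 ^ k / n) := by
  have hc := card_treeParam_pos (k := k) hd han
  have hc' : (0 : ℝ) < Fintype.card (TreeParam n d a k) := by exact_mod_cast hc
  have ha' : (0 : ℝ) < a := by exact_mod_cast ha
  have hn' : (0 : ℝ) < n := by exact_mod_cast ha.trans_le han
  rw [weight, div_le_iff₀ hc']
  calc _ ≤ ∑ θ : TreeParam n d a k, (2 * 2 ^ k / a) * (if i ∈ θ.1.1 then (1 : ℝ) else 0) := by
        refine Finset.sum_le_sum fun θ _ => ?_
        by_cases hi : i ∈ treeLeaf D θ x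
        · rw [if_pos hi, if_pos (leaf_subset D x k θ.2 θ.1 hi), mul_one]
          have hp : (0 : ℝ) < (treeLeaf D θ x).card := by
            exact_mod_cast Finset.card_pos.2 ⟨i, hi⟩
          have := h θ
          rw [inv_eq_one_div, div_le_div_iff₀ hp ha', one_mul]
          exact_mod_cast this
        · rw [if_neg hi]
          positivity
    _ = (2 * 2 ^ k / a) * (Fintype.card (SplitDirections d k) *
          ∑ S : {S : Finset (Fin n) // S.card = a}, (if i ∈ S.1 then (1 : ℝ) else 0)) := by
        rw [← Finset.mul_sum, Fintype.sum_prod_type,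
          Finset.mul_sum _ _ (Fintype.card (SplitDirections d k) : ℝ)]
        refine congrArg (fun t => 2 * 2 ^ k / (a : ℝ) * t) (Finset.sum_congr rfl fun S _ => ?_)
        rw [← Finset.card_univ, ← nsmul_eq_mul, ← Finset.sum_const]
    _ = 2 * (2 ^ k / n) * Fintype.card (TreeParam n d a k) := by
        have e := card_mul_sum_mem_eq (a := a) i
        rw [Fintype.card_prod]
        push_cast
        have e' : ∑ S : {S : Finset (Fin n) // S.card = a}, (if i ∈ S.1 then (1 : ℝ) else 0)
            = a * Fintype.card {S : Finset (Fin n) // S.card = a} / n := by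
          rw [← e]; field_simp
        rw [e']
        field_simp

end Weight

/-! ### The bias -/

section Bias

variable {n d a k : ℕ} {σ2 : ℝ} {L : ℝ≥0} {m : EuclideanSpace ℝ (Fin d) → ℝ}
  {P : Measure (EuclideanSpace ℝ (Fin d) × ℝ)}

/-- The bias of the forest estimate at `x`, given the positions of the observations. -/
noncomputable def bias (m : EuclideanSpace ℝ (Fin d) → ℝ) (a k : ℕ)
    (x : EuclideanSpace ℝ (Fin d)) (X : Fin n → EuclideanSpace ℝ (Fin d)) : ℝ :=
  ∑ i, weight a k x i (fun l => (X l, 0)) * (cubeMean m (X i) - m x)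

theorem measurable_bias (hm : LipschitzOnWith L m (unitCube d)) (x : EuclideanSpace ℝ (Fin d)) :
    Measurable fun X : Fin n → EuclideanSpace ℝ (Fin d) => bias m a k x X :=
  Finset.measurable_sum _ fun i _ => (measurable_weight x i).mul
    (((measurable_cubeMean hm).comp (measurable_pi_apply i)).sub_const _)

theorem exists_abs_bias_le (hm : LipschitzOnWith L m (unitCube d))
    (x : EuclideanSpace ℝ (Fin d)) :
    ∃ B, ∀ X : Fin n → EuclideanSpace ℝ (Fin d), |bias m a k x X| ≤ B := by
  obtain ⟨B, hB⟩ := exists_abs_cubeMean_le hm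
  refine ⟨∑ _i : Fin n, 1 * (B + |m x|), fun X => ?_⟩
  refine (Finset.abs_sum_le_sum_abs _ _).trans (Finset.sum_le_sum fun i _ => ?_)
  rw [abs_mul]
  have h1 : |cubeMean m (X i) - m x| ≤ B + |m x| :=
    (abs_sub _ _).trans (by linarith [hB (X i)])
  exact mul_le_mul (abs_weight_le_one x i _) h1 (abs_nonneg _) zero_le_one

theorem sq_tree_bias_le (hm : LipschitzOnWith L m (unitCube d)) {x : EuclideanSpace ℝ (Fin d)}
    (hx : x ∈ unitCube d) {D : Sample n d} (hD : ∀ i, (D i).1 ∈ unitCube d)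
    (θ : TreeParam n d a k) (h : (treeLeaf D θ x).Nonempty) :
    (∑ i, (if i ∈ treeLeaf D θ x then ((treeLeaf D θ x).card : ℝ)⁻¹ else 0)
        * (cubeMean m (D i).1 - m x)) ^ 2
      ≤ (L : ℝ) ^ 2 * ∑ j, side (fun i => (D i).1) x j k θ.2 θ.1 0 1 ^ 2 := by
  set R := ∑ j, side (fun i => (D i).1) x j k θ.2 θ.1 0 1 ^ 2 with hR
  have hR0 : 0 ≤ R := Finset.sum_nonneg fun j _ => sq_nonneg _
  have hone : ∀ i ∈ treeLeaf D θ x, |cubeMean m (D i).1 - m x| ≤ L * √R := by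
    intro i hi
    rw [cubeMean, Set.indicator_of_mem (hD i), ← Real.dist_eq]
    refine (hm.dist_le_mul _ (hD i) _ hx).trans (mul_le_mul_of_nonneg_left ?_ L.2)
    rw [EuclideanSpace.dist_eq]
    refine Real.sqrt_le_sqrt (Finset.sum_le_sum fun j _ => ?_)
    rw [Real.dist_eq]
    refine pow_le_pow_left₀ (abs_nonneg _) ?_ 2
    exact abs_sub_le_side D x j k θ.2 θ.1 0 1 (hx j).1 (hx j).2 (fun q _ => hD q j) i hi
  have habs : |∑ i, (if i ∈ treeLeaf D θ x then ((treeLeaf D θ x).card : ℝ)⁻¹ else 0)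
        * (cubeMean m (D i).1 - m x)| ≤ L * √R := by
    calc _ ≤ ∑ i, |(if i ∈ treeLeaf D θ x then ((treeLeaf D θ x).card : ℝ)⁻¹ else 0)
          * (cubeMean m (D i).1 - m x)| := Finset.abs_sum_le_sum_abs _ _
      _ ≤ ∑ i, (if i ∈ treeLeaf D θ x then ((treeLeaf D θ x).card : ℝ)⁻¹ else 0)
          * (L * √R) := by
          refine Finset.sum_le_sum fun i _ => ?_
          split_ifs with hi
          · rw [abs_mul, abs_of_nonneg (by positivity)]
            exact mul_le_mul_of_nonneg_left (hone i hi) (by positivity)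
          · simp
      _ = L * √R := by rw [← Finset.sum_mul, sum_inv_card_treeLeaf x D θ h, one_mul]
  calc _ = |∑ i, (if i ∈ treeLeaf D θ x then ((treeLeaf D θ x).card : ℝ)⁻¹ else 0)
        * (cubeMean m (D i).1 - m x)| ^ 2 := (sq_abs _).symm
    _ ≤ (L * √R) ^ 2 := pow_le_pow_left₀ (abs_nonneg _) habs 2
    _ = _ := by rw [mul_pow, Real.sq_sqrt hR0]

/-- The forest bias is the mean of the tree biases, and by Cauchy–Schwarz its square is at most the
mean of their squares. -/
theorem sq_bias_le (hd : 0 < d) (han : a ≤ n) (hm : LipschitzOnWith L m (unitCube d))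
    {x : EuclideanSpace ℝ (Fin d)}
    (hx : x ∈ unitCube d) {D : Sample n d} (hD : ∀ i, (D i).1 ∈ unitCube d)
    (h : ∀ θ : TreeParam n d a k, (treeLeaf D θ x).Nonempty) :
    bias m a k x (fun l => (D l).1) ^ 2 ≤ (∑ θ : TreeParam n d a k,
      (L : ℝ) ^ 2 * ∑ j, side (fun i => (D i).1) x j k θ.2 θ.1 0 1 ^ 2)
        / Fintype.card (TreeParam n d a k) := by
  have hc : (0 : ℝ) < Fintype.card (TreeParam n d a k) := by
    exact_mod_cast card_treeParam_pos (k := k) hd han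
  have e : bias m a k x (fun l => (D l).1) = (∑ θ : TreeParam n d a k,
      ∑ i, (if i ∈ treeLeaf D θ x then ((treeLeaf D θ x).card : ℝ)⁻¹ else 0)
        * (cubeMean m (D i).1 - m x)) / Fintype.card (TreeParam n d a k) := by
    have hw : bias m a k x (fun l => (D l).1)
        = ∑ i, weight a k x i D * (cubeMean m (D i).1 - m x) :=
      Finset.sum_congr rfl fun i _ => by rw [weight_eq_positions x i D]
    rw [hw]
    simp only [weight]
    rw [Finset.sum_comm, Finset.sum_div]
    refine Finset.sum_congr rfl fun i _ => ?_
    rw [← Finset.sum_mul]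
    ring
  rw [e, div_pow, sq (Fintype.card (TreeParam n d a k) : ℝ), ← div_div]
  refine div_le_div_of_nonneg_right ?_ hc.le
  rw [div_le_iff₀ hc, mul_comm]
  refine sq_sum_le_card_mul_sum_sq.trans ?_
  rw [Finset.card_univ]
  exact mul_le_mul_of_nonneg_left
    (Finset.sum_le_sum fun θ _ => sq_tree_bias_le hm hx hD θ (h θ)) hc.le

theorem sum_treeParam_side_eq (hd : 0 < d) (X : Fin n → Fin d → ℝ) (x : Fin d → ℝ) :
    ENNReal.ofReal ((∑ θ : TreeParam n d a k,
      (L : ℝ) ^ 2 * ∑ j, side X x j k θ.2 θ.1 0 1 ^ 2) / Fintype.card (TreeParam n d a k))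
      = ENNReal.ofReal (L ^ 2 / Fintype.card (TreeParam n d a k))
        * ∑ j, ∑ S : {S : Finset (Fin n) // S.card = a},
          Fintype.card (SplitDirections d k) * meanSqSide X x j k S 0 1 := by
  rw [← Finset.mul_sum, mul_div_right_comm, ENNReal.ofReal_mul (by positivity),
    ENNReal.ofReal_sum_of_nonneg fun θ _ => Finset.sum_nonneg fun j _ => sq_nonneg _]
  congr 1
  simp only [ENNReal.ofReal_sum_of_nonneg fun j _ => sq_nonneg (side X x j k _ _ 0 1)]
  rw [Finset.sum_comm]
  refine Finset.sum_congr rfl fun j _ => ?_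
  rw [Fintype.sum_prod_type]
  exact Finset.sum_congr rfl fun S _ => sum_side_sq hd X x j k S 0 1

theorem RegressionModel.integral_sq_bias_le (h : RegressionModel d σ2 L m P) (hd : 0 < d)
    (han : a ≤ n) (hak : 4 * 2 ^ k ≤ a) {x : EuclideanSpace ℝ (Fin d)} (hx : x ∈ unitCube d)
    (hne : ∀ᵐ D ∂sampleLaw P n, ∀ θ : TreeParam n d a k, (treeLeaf D θ x).Nonempty) :
    ∫ D, bias m a k x (fun l => (D l).1) ^ 2 ∂sampleLaw P n
      ≤ d * (L : ℝ) ^ 2 * C1 d * beta d ^ k := by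
  have hβ := beta_pos hd
  have hc := card_treeParam_pos (k := k) hd han
  have hc' : (0 : ℝ) < Fintype.card (TreeParam n d a k) := by exact_mod_cast hc
  have hmeas : ∀ (j : Fin d) (S : Finset (Fin n)), Measurable fun D : Sample n d =>
      meanSqSide (fun i => (D i).1) x j k S 0 1 := fun j S =>
    measurable_meanSqSide x j k S
      (measurable_pi_lambda _ fun i => measurable_position.comp (measurable_pi_apply i))
      measurable_const measurable_const
  have hmeas' : ∀ j : Fin d, Measurable fun D : Sample n d =>
      ∑ S : {S : Finset (Fin n) // S.card = a}, (Fintype.card (SplitDirections d k) : ENNReal)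
        * meanSqSide (fun i => (D i).1) x j k S 0 1 := fun j =>
    Finset.measurable_sum _ fun S _ => (hmeas j S).const_mul _
  have hb : Measurable fun D : Sample n d => bias m a k x (fun l => (D l).1) :=
    (measurable_bias h.lipschitz x).comp measurable_positions
  have hC1 : 0 < C1 d := Real.exp_pos _
  -- Each of the `d` directions contributes `C1 d * beta d ^ k`, for every subsample; averaging over
  -- the trees leaves this bound unchanged.
  have key : ∫⁻ D, ENNReal.ofReal (bias m a k x (fun l => (D l).1) ^ 2) ∂sampleLaw P n
      ≤ ENNReal.ofReal (d * (L : ℝ) ^ 2 * C1 d * beta d ^ k) := by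
    calc _ ≤ ∫⁻ D, ENNReal.ofReal (L ^ 2 / Fintype.card (TreeParam n d a k))
        * ∑ j, ∑ S : {S : Finset (Fin n) // S.card = a},
          Fintype.card (SplitDirections d k) * meanSqSide (fun i => (D i).1) x j k S 0 1
            ∂sampleLaw P n := by
          refine lintegral_mono_ae ?_
          filter_upwards [h.ae_forall_mem_unitCube n, hne] with D hD hD'
          rw [← sum_treeParam_side_eq hd]
          exact ENNReal.ofReal_le_ofReal (sq_bias_le hd han h.lipschitz hx hD hD')
      _ = ENNReal.ofReal (L ^ 2 / Fintype.card (TreeParam n d a k))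
        * ∑ j, ∑ S : {S : Finset (Fin n) // S.card = a},
          Fintype.card (SplitDirections d k)
            * ∫⁻ D, meanSqSide (fun i => (D i).1) x j k S 0 1 ∂sampleLaw P n := by
          rw [lintegral_const_mul _ (Finset.measurable_sum _ fun j _ => hmeas' j),
            lintegral_finsetSum _ fun j _ => hmeas' j]
          congr 1
          refine Finset.sum_congr rfl fun j _ => ?_
          rw [lintegral_finsetSum _ fun (S : {S : Finset (Fin n) // S.card = a}) _ =>
            (hmeas j S.1).const_mul _]
          refine Finset.sum_congr rfl fun S _ => ?_
          rw [lintegral_const_mul _ (hmeas j S)]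
      _ ≤ ENNReal.ofReal (L ^ 2 / Fintype.card (TreeParam n d a k))
        * ∑ _j : Fin d, ∑ _S : {S : Finset (Fin n) // S.card = a},
          Fintype.card (SplitDirections d k) * ENNReal.ofReal (C1 d * beta d ^ k) := by
          gcongr with j _ S _
          refine h.lintegral_meanSqSide_le hd x j ?_
          rw [S.2, pow_add]
          omega
      _ = ENNReal.ofReal (d * (L : ℝ) ^ 2 * C1 d * beta d ^ k) := by
          simp only [Finset.sum_const, Finset.card_univ, nsmul_eq_mul, Fintype.card_fin]
          rw [← ENNReal.ofReal_natCast, ← ENNReal.ofReal_natCast, ← ENNReal.ofReal_natCast,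
            ← ENNReal.ofReal_mul (Nat.cast_nonneg _), ← ENNReal.ofReal_mul (Nat.cast_nonneg _),
            ← ENNReal.ofReal_mul (Nat.cast_nonneg _), ← ENNReal.ofReal_mul (by positivity)]
          congr 1
          have e : (Fintype.card (TreeParam n d a k) : ℝ)
              = Fintype.card {S : Finset (Fin n) // S.card = a}
                * Fintype.card (SplitDirections d k) := by
            rw [Fintype.card_prod]; push_cast; rfl
          rw [div_mul_eq_mul_div, div_eq_iff hc'.ne', e]
          ring
  rw [integral_eq_lintegral_of_nonneg_ae (Filter.Eventually.of_forall fun D => sq_nonneg _)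
    (hb.pow_const 2).aestronglyMeasurable]
  exact ENNReal.toReal_le_of_le_ofReal (by positivity) key

end Bias

/-! ### The risk of a median forest -/

section Risk

variable {n d a k : ℕ} {σ2 : ℝ} {L : ℝ≥0} {m : EuclideanSpace ℝ (Fin d) → ℝ}
  {P : Measure (EuclideanSpace ℝ (Fin d) × ℝ)}

/-- The noise part of the forest estimate at `x`. -/
noncomputable def noisePart (m : EuclideanSpace ℝ (Fin d) → ℝ) (a k : ℕ)
    (x : EuclideanSpace ℝ (Fin d)) (D : Sample n d) : ℝ :=
  ∑ i, weight a k x i (fun l => ((D l).1, 0)) * noise m (D i)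

/-- Since the weights sum to one, `m x` can be distributed over the observations. Using `cubeMean`
in both parts makes the identity hold even for data off the cube. -/
theorem forestEstimate_sub_eq {x : EuclideanSpace ℝ (Fin d)} {D : Sample n d}
    (h : ∑ i, weight a k x i D = 1) :
    forestEstimate a k D x - m x
      = noisePart m a k x D + bias m a k x (fun l => (D l).1) := by
  have h' : ∑ i, weight a k x i (fun l => ((D l).1, 0)) = 1 := by
    rw [← h]
    exact Finset.sum_congr rfl fun i _ => (weight_eq_positions x i D).symm
  rw [forestEstimate_eq_sum_weight, noisePart, bias, ← Finset.sum_add_distrib]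
  calc _ = ∑ i, weight a k x i D * (D i).2
        - (∑ i, weight a k x i (fun l => ((D l).1, 0))) * m x := by rw [h', one_mul]
    _ = _ := by
      rw [Finset.sum_mul, ← Finset.sum_sub_distrib]
      refine Finset.sum_congr rfl fun i _ => ?_
      rw [← weight_eq_positions x i D, noise]
      ring

theorem RegressionModel.isProbabilityMeasure_sampleLaw (h : RegressionModel d σ2 L m P) (n : ℕ) :
    IsProbabilityMeasure (sampleLaw P n) := by
  have := h.isProbabilityMeasure
  rw [sampleLaw]
  infer_instance

theorem RegressionModel.memLp_noise_sample (h : RegressionModel d σ2 L m P) (i : Fin n) :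
    MemLp (fun D => noise m (D i)) 2 (sampleLaw P n) := by
  have := h.isProbabilityMeasure
  exact h.memLp_noise.comp_measurePreserving (measurePreserving_eval (fun _ : Fin n => P) i)

theorem measurable_weight_sample (x : EuclideanSpace ℝ (Fin d)) (i : Fin n) :
    Measurable fun D : Sample n d => weight a k x i (fun l => ((D l).1, 0)) :=
  (measurable_weight x i).comp measurable_positions

theorem RegressionModel.memLp_noisePart (h : RegressionModel d σ2 L m P)
    (x : EuclideanSpace ℝ (Fin d)) :
    MemLp (fun D => noisePart m a k x D) 2 (sampleLaw P n) := by
  refine memLp_finsetSum _ fun i _ => ?_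
  refine (h.memLp_noise_sample i).mono ((measurable_weight_sample x i).mul
    (h.measurable_noise.comp (measurable_pi_apply i))).aestronglyMeasurable
    (Filter.Eventually.of_forall fun D => ?_)
  rw [norm_mul]
  exact mul_le_of_le_one_left (norm_nonneg _) (abs_weight_le_one x i _)

theorem RegressionModel.memLp_bias (h : RegressionModel d σ2 L m P)
    (x : EuclideanSpace ℝ (Fin d)) :
    MemLp (fun D : Sample n d => bias m a k x fun l => (D l).1) 2 (sampleLaw P n) := by
  have := h.isProbabilityMeasure_sampleLaw n
  obtain ⟨B, hB⟩ := exists_abs_bias_le (n := n) (a := a) (k := k) h.lipschitz x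
  exact MemLp.of_bound ((measurable_bias h.lipschitz x).comp
    measurable_positions).aestronglyMeasurable B (Filter.Eventually.of_forall fun D => hB _)

/-- The noise part is uncorrelated with the bias. -/
theorem RegressionModel.integral_bias_mul_noisePart (h : RegressionModel d σ2 L m P)
    (x : EuclideanSpace ℝ (Fin d)) :
    ∫ D : Sample n d, bias m a k x (fun l => (D l).1) * noisePart m a k x D ∂sampleLaw P n = 0 := by
  obtain ⟨B, hB⟩ := exists_abs_bias_le (n := n) (a := a) (k := k) h.lipschitz x
  have hmeas : ∀ i, Measurable fun X : Fin n → EuclideanSpace ℝ (Fin d) =>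
      bias m a k x X * weight a k x i (fun l => (X l, 0)) := fun i =>
    (measurable_bias h.lipschitz x).mul (measurable_weight x i)
  have hbd : ∀ (i : Fin n) (X : Fin n → EuclideanSpace ℝ (Fin d)),
      |bias m a k x X * weight a k x i (fun l => (X l, 0))| ≤ B := by
    intro i X
    rw [abs_mul]
    exact (mul_le_of_le_one_right (abs_nonneg _) (abs_weight_le_one x i _)).trans (hB X)
  have hint : ∀ i : Fin n, Integrable (fun D : Sample n d =>
      bias m a k x (fun l => (D l).1) * weight a k x i (fun l => ((D l).1, 0)) * 1
        * noise m (D i)) (sampleLaw P n) := by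
    intro i
    have := h.isProbabilityMeasure_sampleLaw n
    simp only [mul_one]
    exact integrable_bounded_mul ((hmeas i).comp measurable_positions) (fun D => hbd i _)
      ((h.memLp_noise_sample i).integrable (by norm_num))
  calc _ = ∫ D : Sample n d, ∑ i, bias m a k x (fun l => (D l).1)
          * weight a k x i (fun l => ((D l).1, 0)) * 1 * noise m (D i) ∂sampleLaw P n := by
        congr 1; ext D
        rw [noisePart, Finset.mul_sum]
        exact Finset.sum_congr rfl fun i _ => by ring
    _ = ∑ i, ∫ D : Sample n d, bias m a k x (fun l => (D l).1)
          * weight a k x i (fun l => ((D l).1, 0)) * 1 * noise m (D i) ∂sampleLaw P n :=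
        integral_finsetSum _ fun i _ => hint i
    _ = 0 := Finset.sum_eq_zero fun i _ =>
        h.integral_mul_noise_eq_zero i (hmeas i) (hbd i) (A := fun _ => 1) (fun _ _ => rfl) (hint i)

/-- Off-diagonal products vanish by resampling one of the two observations, the other's noise
playing the part of `A`; the diagonal is bounded by the conditional variance. -/
theorem RegressionModel.integral_sq_noisePart_le (h : RegressionModel d σ2 L m P)
    (x : EuclideanSpace ℝ (Fin d)) :
    ∫ D : Sample n d, noisePart m a k x D ^ 2 ∂sampleLaw P n
      ≤ σ2 * ∫ D : Sample n d, ∑ i, weight a k x i (fun l => ((D l).1, 0)) ^ 2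
          ∂sampleLaw P n := by
  have := h.isProbabilityMeasure_sampleLaw n
  have hmeas : ∀ i q, Measurable fun X : Fin n → EuclideanSpace ℝ (Fin d) =>
      weight a k x i (fun l => (X l, 0)) * weight a k x q (fun l => (X l, 0)) := fun i q =>
    (measurable_weight x i).mul (measurable_weight x q)
  have hbd : ∀ (i q : Fin n) (X : Fin n → EuclideanSpace ℝ (Fin d)),
      |weight a k x i (fun l => (X l, 0)) * weight a k x q (fun l => (X l, 0))| ≤ 1 := by
    intro i q X
    rw [abs_mul]
    exact mul_le_one₀ (abs_weight_le_one x i _) (abs_nonneg _) (abs_weight_le_one x q _)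
  have hint : ∀ i q : Fin n, Integrable (fun D : Sample n d =>
      weight a k x i (fun l => ((D l).1, 0)) * weight a k x q (fun l => ((D l).1, 0))
        * noise m (D q) * noise m (D i)) (sampleLaw P n) := by
    intro i q
    have h2 : Integrable (fun D : Sample n d => noise m (D q) * noise m (D i)) (sampleLaw P n) :=
      (h.memLp_noise_sample q).integrable_mul (h.memLp_noise_sample i)
    simp only [mul_assoc _ (noise m _)]
    exact integrable_bounded_mul ((hmeas i q).comp measurable_positions) (fun D => hbd i q _) h2
  have hsq : ∀ i : Fin n, Integrable (fun D : Sample n d =>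
      weight a k x i (fun l => ((D l).1, 0)) ^ 2) (sampleLaw P n) := fun i =>
    Integrable.of_bound ((measurable_weight_sample x i).pow_const 2).aestronglyMeasurable 1
      (Filter.Eventually.of_forall fun D => by
        rw [sq]; exact hbd i i fun l => (D l).1)
  calc _ = ∫ D : Sample n d, ∑ i, ∑ q, weight a k x i (fun l => ((D l).1, 0))
          * weight a k x q (fun l => ((D l).1, 0)) * noise m (D q) * noise m (D i)
            ∂sampleLaw P n := by
        congr 1; ext D
        rw [noisePart, sq, Finset.sum_mul_sum]
        exact Finset.sum_congr rfl fun i _ => Finset.sum_congr rfl fun q _ => by ring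
    _ = ∑ i, ∑ q, ∫ D : Sample n d, weight a k x i (fun l => ((D l).1, 0))
          * weight a k x q (fun l => ((D l).1, 0)) * noise m (D q) * noise m (D i)
            ∂sampleLaw P n := by
        rw [integral_finsetSum _ fun i _ => integrable_finsetSum _ fun q _ => hint i q]
        exact Finset.sum_congr rfl fun i _ => integral_finsetSum _ fun q _ => hint i q
    _ = ∑ i, ∫ D : Sample n d, weight a k x i (fun l => ((D l).1, 0))
          * weight a k x i (fun l => ((D l).1, 0)) * noise m (D i) ^ 2 ∂sampleLaw P n := by
        refine Finset.sum_congr rfl fun i _ => ?_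
        rw [Finset.sum_eq_single i]
        · congr 1; ext D; ring
        · intro q _ hq
          refine h.integral_mul_noise_eq_zero i (hmeas i q) (hbd i q)
            (A := fun D => noise m (D q)) (fun D z => ?_) (hint i q)
          rw [Function.update_of_ne hq]
        · simp
    _ ≤ ∑ i, σ2 * ∫ D : Sample n d, weight a k x i (fun l => ((D l).1, 0)) ^ 2
          ∂sampleLaw P n := by
        refine Finset.sum_le_sum fun i _ => ?_
        refine (h.integral_mul_noise_sq_sample_le i (hmeas i i) (hbd i i)
          (fun X => mul_self_nonneg _)).trans (le_of_eq ?_)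
        simp only [sq]
    _ = _ := by
        rw [← Finset.mul_sum, integral_finsetSum _ fun i _ => hsq i]

/-- The risk of the infinite median forest. -/
theorem RegressionModel.memLp_and_risk_le (h : RegressionModel d σ2 L m P) (hd : 0 < d)
    (hσ2 : 0 ≤ σ2) (han : a ≤ n) (hak : 4 * 2 ^ k ≤ a) {x : EuclideanSpace ℝ (Fin d)}
    (hx : x ∈ unitCube d) :
    MemLp (fun D => forestEstimate a k D x - m x) 2 (sampleLaw P n) ∧
      ∫ D, (forestEstimate a k D x - m x) ^ 2 ∂sampleLaw P n ≤ riskBound d σ2 L n k := by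
  have := h.isProbabilityMeasure_sampleLaw n
  have hpow : 0 < 2 ^ k := by positivity
  have ha : 0 < a := by omega
  have hcard : ∀ᵐ D ∂sampleLaw P n, ∀ θ : TreeParam n d a k,
      a ≤ 2 * 2 ^ k * (treeLeaf D θ x).card := by
    filter_upwards [h.ae_injective n] with D hD θ
    exact le_two_mul_two_pow_mul_card_treeLeaf hD hak θ x
  have hne : ∀ᵐ D ∂sampleLaw P n, ∀ θ : TreeParam n d a k, (treeLeaf D θ x).Nonempty := by
    filter_upwards [hcard] with D hD θ
    rw [← Finset.card_pos]
    by_contra h0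
    have := hD θ
    rw [Nat.eq_zero_of_not_pos h0, mul_zero] at this
    omega
  have hsum : ∀ᵐ D ∂sampleLaw P n, ∑ i, weight a k x i D = 1 := by
    filter_upwards [hne] with D hD using sum_weight hd han x hD
  have heq : (fun D => forestEstimate a k D x - m x) =ᵐ[sampleLaw P n]
      fun D => noisePart m a k x D + bias m a k x (fun l => (D l).1) := by
    filter_upwards [hsum] with D hD using forestEstimate_sub_eq hD
  have hN := h.memLp_noisePart (n := n) (a := a) (k := k) x
  have hB := h.memLp_bias (n := n) (a := a) (k := k) x
  refine ⟨(memLp_congr_ae heq).2 (hN.add hB), ?_⟩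
  -- The sum of squared weights is at most a bound on the weights times their sum, which is one.
  have hsq : ∫ D : Sample n d, ∑ i, weight a k x i (fun l => ((D l).1, 0)) ^ 2 ∂sampleLaw P n
      ≤ 2 * (2 ^ k / n) := by
    calc _ ≤ ∫ _, (2 * (2 ^ k / n) : ℝ) ∂sampleLaw P n := by
          refine integral_mono_of_nonneg (Filter.Eventually.of_forall fun D =>
            Finset.sum_nonneg fun i _ => sq_nonneg _) (integrable_const _) ?_
          filter_upwards [hcard, hsum] with D hD hD1
          calc ∑ i, weight a k x i (fun l => ((D l).1, 0)) ^ 2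
              ≤ ∑ i, 2 * (2 ^ k / n) * weight a k x i D := by
                refine Finset.sum_le_sum fun i _ => ?_
                rw [← weight_eq_positions x i D, sq]
                exact mul_le_mul_of_nonneg_right (weight_le hd ha han x i hD)
                  (weight_nonneg x i D)
            _ = 2 * (2 ^ k / n) := by rw [← Finset.mul_sum, hD1, mul_one]
      _ = _ := by simp
  have h1 : Integrable (fun D : Sample n d => noisePart m a k x D ^ 2) (sampleLaw P n) :=
    hN.integrable_sq
  have h2 : Integrable (fun D : Sample n d => bias m a k x (fun l => (D l).1) ^ 2)
      (sampleLaw P n) := hB.integrable_sq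
  have h3 : Integrable (fun D : Sample n d => bias m a k x (fun l => (D l).1)
      * noisePart m a k x D) (sampleLaw P n) := hB.integrable_mul hN
  calc ∫ D, (forestEstimate a k D x - m x) ^ 2 ∂sampleLaw P n
      = ∫ D, (noisePart m a k x D ^ 2 + 2 * (bias m a k x (fun l => (D l).1)
          * noisePart m a k x D) + bias m a k x (fun l => (D l).1) ^ 2) ∂sampleLaw P n := by
        refine integral_congr_ae ?_
        filter_upwards [heq] with D hD
        rw [hD]
        ring
    _ = ∫ D, noisePart m a k x D ^ 2 ∂sampleLaw P n
        + ∫ D, bias m a k x (fun l => (D l).1) ^ 2 ∂sampleLaw P n := by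
        have h12 : Integrable (fun D : Sample n d => noisePart m a k x D ^ 2
            + 2 * (bias m a k x (fun l => (D l).1) * noisePart m a k x D)) (sampleLaw P n) :=
          h1.add (h3.const_mul 2)
        rw [integral_add h12 h2, integral_add h1 (h3.const_mul 2),
          integral_const_mul, h.integral_bias_mul_noisePart x, mul_zero, add_zero]
    _ ≤ riskBound d σ2 L n k := by
        have e1 := (h.integral_sq_noisePart_le (n := n) (a := a) (k := k) x).trans
          (mul_le_mul_of_nonneg_left hsq hσ2)
        have e2 := h.integral_sq_bias_le hd han hak hx hne
        rw [riskBound, Real.rpow_natCast, Real.rpow_natCast]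
        linarith

end Risk

/-! ### The optimal subsample size -/

section Optimum

variable {d : ℕ} {σ2 : ℝ} {L : ℝ≥0}

theorem log_beta_neg (hd : 0 < d) : Real.log (beta d) < 0 := by
  have h : (0 : ℝ) < d := by exact_mod_cast hd
  refine Real.log_neg (beta_pos hd) ?_
  rw [beta]
  have : 0 < 3 / (4 * (d : ℝ)) := by positivity
  linarith

theorem C4_pos (d : ℕ) (σ2 : ℝ) (L : ℝ≥0) : 0 < C4 d σ2 L := by
  rw [C4]; positivity

theorem optimalSize_pos (d : ℕ) (σ2 : ℝ) (L : ℝ≥0) {n : ℕ} (hn : 0 < n) :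
    0 < optimalSize d σ2 L n := by
  have := C4_pos d σ2 L
  have : (0 : ℝ) < n := by exact_mod_cast hn
  rw [optimalSize]; positivity

theorem logb_optimalSize (d : ℕ) (σ2 : ℝ) (L : ℝ≥0) {n : ℕ} (hn : 0 < n) :
    Real.logb 2 (optimalSize d σ2 L n) - 2
      = 1 / (Real.log 2 - Real.log (beta d)) * (Real.log n + C3 d σ2 L) := by
  have hn' : (0 : ℝ) < n := by exact_mod_cast hn
  have h2 : Real.log 2 ≠ 0 := (Real.log_pos one_lt_two).ne'
  have h4 : Real.log 4 = 2 * Real.log 2 := by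
    rw [show (4 : ℝ) = 2 ^ 2 by norm_num, Real.log_pow]; norm_num
  rw [Real.logb, optimalSize, Real.log_mul (C4_pos d σ2 L).ne' (by positivity), C4,
    Real.log_mul (by norm_num) (by positivity), Real.log_rpow (by norm_num), Real.log_rpow hn', h4]
  field_simp
  ring

/-- Two exponentials, one increasing and one decreasing, whose slopes are opposite at `s`, have
their sum minimal at `s` only. -/
theorem add_rpow_lt_of_slope_eq {A B p q s t : ℝ} (hp : 1 < p) (hq0 : 0 < q) (hq : q < 1)
    (hA : 0 < A) (hB : 0 < B)
    (hs : A * p ^ s * Real.log p = -(B * q ^ s * Real.log q)) (hst : t ≠ s) :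
    A * p ^ s + B * q ^ s < A * p ^ t + B * q ^ t := by
  have hlp : 0 < Real.log p := Real.log_pos hp
  have hlq : Real.log q < 0 := Real.log_neg hq0 hq
  have hp0 : 0 < p := by linarith
  have hu : t - s ≠ 0 := sub_ne_zero.2 hst
  have e : ∀ r : ℝ, 0 < r → r ^ t = r ^ s * Real.exp (Real.log r * (t - s)) := by
    intro r hr
    rw [← Real.rpow_def_of_pos hr, ← Real.rpow_add hr]
    congr 1; ring
  have i1 := Real.add_one_lt_exp (mul_ne_zero hlp.ne' hu)
  have i2 := Real.add_one_lt_exp (mul_ne_zero hlq.ne hu)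
  have hAp : 0 < A * p ^ s := by positivity
  have hBq : 0 < B * q ^ s := by positivity
  have j1 := mul_lt_mul_of_pos_left i1 hAp
  have j2 := mul_lt_mul_of_pos_left i2 hBq
  rw [e p hp0, e q hq0]
  have hz : A * p ^ s * (Real.log p * (t - s)) + B * q ^ s * (Real.log q * (t - s)) = 0 := by
    have : A * p ^ s * (Real.log p * (t - s)) + B * q ^ s * (Real.log q * (t - s))
        = (A * p ^ s * Real.log p + B * q ^ s * Real.log q) * (t - s) := by ring
    rw [this, hs]; ring
  linarith

/-- In the depth the bound is `A * 2 ^ s + B * β ^ s`. Equal and opposite slopes mean `(2 / β) ^ s =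
n * exp C₃`, which is what the formula for the optimal depth solves. -/
theorem riskBound_lt (hd : 0 < d) (hσ2 : 0 < σ2) (hL : 0 < L) {n : ℕ} (hn : 0 < n) {a : ℝ}
    (ha : 0 < a) (hne : a ≠ optimalSize d σ2 L n) :
    riskBound d σ2 L n (Real.logb 2 (optimalSize d σ2 L n) - 2)
      < riskBound d σ2 L n (Real.logb 2 a - 2) := by
  have hn' : (0 : ℝ) < n := by exact_mod_cast hn
  have hd' : (0 : ℝ) < d := by exact_mod_cast hd
  have hL' : (0 : ℝ) < L := by exact_mod_cast hL
  have hC1 : 0 < C1 d := Real.exp_pos _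
  have hβ := beta_pos hd
  have hlβ := log_beta_neg hd
  have hl2 : 0 < Real.log 2 := Real.log_pos one_lt_two
  set s := Real.logb 2 (optimalSize d σ2 L n) - 2 with hs
  have hs' : s * (Real.log 2 - Real.log (beta d)) = Real.log n + C3 d σ2 L := by
    rw [hs, logb_optimalSize d σ2 L hn]
    have : Real.log 2 - Real.log (beta d) ≠ 0 := by linarith
    field_simp
  have hβ1 : beta d < 1 := by
    by_contra h
    exact absurd (Real.log_nonneg (not_lt.1 h)) (not_le.2 hlβ)
  have hB : 0 < (d : ℝ) * (L : ℝ) ^ 2 * C1 d := by positivity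
  have hA : 0 < 2 * σ2 / n := by positivity
  have hr : ∀ r, riskBound d σ2 L n r
      = 2 * σ2 / n * 2 ^ r + (d : ℝ) * (L : ℝ) ^ 2 * C1 d * beta d ^ r := by
    intro r; rw [riskBound]; ring
  rw [hr, hr]
  refine add_rpow_lt_of_slope_eq one_lt_two hβ hβ1 hA hB ?_ ?_
  · have hQ : 0 < -((d : ℝ) * (L : ℝ) ^ 2 * C1 d * Real.log (beta d)) / (2 * σ2 * Real.log 2) := by
      have := mul_neg_of_pos_of_neg hB hlβ
      exact div_pos (by linarith) (by positivity)
    have hexp : (2 : ℝ) ^ s = beta d ^ s * (n * (-((d : ℝ) * (L : ℝ) ^ 2 * C1 d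
        * Real.log (beta d)) / (2 * σ2 * Real.log 2))) := by
      rw [Real.rpow_def_of_pos two_pos, Real.rpow_def_of_pos hβ]
      nth_rewrite 1 [← Real.exp_log hn']
      rw [← Real.exp_log hQ, ← Real.exp_add, ← Real.exp_add]
      rw [C3] at hs'
      congr 1
      linarith
    rw [hexp]
    field_simp
  · intro h
    refine hne ?_
    have h' : Real.logb 2 a = Real.logb 2 (optimalSize d σ2 L n) := by rw [hs] at h; linarith
    exact Real.logb_injOn_pos one_lt_two ha (optimalSize_pos d σ2 L hn) h'

theorem rate_exponent_mem (hd : 0 < d) :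
    0 < Real.log 2 / (Real.log 2 - Real.log (beta d)) ∧
      Real.log 2 / (Real.log 2 - Real.log (beta d)) < 1 := by
  have hlβ := log_beta_neg hd
  have hl2 : 0 < Real.log 2 := Real.log_pos one_lt_two
  exact ⟨div_pos hl2 (by linarith), (div_lt_one (by linarith)).2 (by linarith)⟩

/-- The exponent `p` of `n` lies strictly between `0` and `1`: `C₄ * n ^ p` tends to infinity, yet
stays below `n` once `n ^ (1 - p) ≥ C₄`. -/
theorem eventually_optimalSize (hd : 0 < d) (σ2 : ℝ) (L : ℝ≥0) :
    ∀ᶠ n : ℕ in atTop, 4 ≤ ⌊optimalSize d σ2 L n⌋₊ ∧ ⌈optimalSize d σ2 L n⌉₊ ≤ n := by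
  obtain ⟨hp0, hp1⟩ := rate_exponent_mem hd
  set p := Real.log 2 / (Real.log 2 - Real.log (beta d)) with hp
  have hC4 := C4_pos d σ2 L
  have h1 : Tendsto (fun n : ℕ => C4 d σ2 L * (n : ℝ) ^ p) atTop atTop :=
    (((tendsto_rpow_atTop hp0).comp tendsto_natCast_atTop_atTop)).const_mul_atTop hC4
  have h2 : Tendsto (fun n : ℕ => (n : ℝ) ^ (1 - p)) atTop atTop :=
    (tendsto_rpow_atTop (by linarith)).comp tendsto_natCast_atTop_atTop
  filter_upwards [h1.eventually_ge_atTop 4, h2.eventually_ge_atTop (C4 d σ2 L),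
    eventually_gt_atTop 0] with n hn1 hn2 hn3
  have hn' : (0 : ℝ) < n := by exact_mod_cast hn3
  refine ⟨Nat.le_floor (by exact_mod_cast hn1), Nat.ceil_le.2 ?_⟩
  calc optimalSize d σ2 L n = C4 d σ2 L * (n : ℝ) ^ p := rfl
    _ ≤ (n : ℝ) ^ (1 - p) * (n : ℝ) ^ p := by gcongr
    _ = n := by rw [← Real.rpow_add hn']; simp

/-- Both roundings, of the size and of its logarithm, keep `2 ^ fullDepth a` within constant factors
of the unrounded size `s`, at which the two terms of the bound have the same order in `n`. -/
theorem riskBound_fullDepth_le (hd : 0 < d) (hσ2 : 0 < σ2) (L : ℝ≥0) {n a : ℕ} (ha : 4 ≤ a)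
    (han : a ≤ n) (h : a = ⌊optimalSize d σ2 L n⌋₊ ∨ a = ⌈optimalSize d σ2 L n⌉₊) :
    riskBound d σ2 L n (fullDepth a)
      ≤ (σ2 * C4 d σ2 L + (d : ℝ) * (L : ℝ) ^ 2 * C1 d
          * ((beta d)⁻¹ ^ 4 * C4 d σ2 L ^ (Real.log (beta d) / Real.log 2)))
        * (n : ℝ) ^ (Real.log (beta d) / (Real.log 2 - Real.log (beta d))) := by
  have hn : 0 < n := by omega
  have hn' : (0 : ℝ) < n := by exact_mod_cast hn
  have hβ := beta_pos hd
  have hlβ := log_beta_neg hd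
  have hl2 : 0 < Real.log 2 := Real.log_pos one_lt_two
  have hC4 := C4_pos d σ2 L
  have hC1 : 0 < C1 d := Real.exp_pos _
  set s := optimalSize d σ2 L n with hs
  have hs0 : 0 < s := optimalSize_pos d σ2 L hn
  have ha' : (4 : ℝ) ≤ a := by exact_mod_cast ha
  have hup : (a : ℝ) < s + 1 := by
    rcases h with h | h
    · rw [h]; linarith [Nat.floor_le hs0.le]
    · rw [h]; exact Nat.ceil_lt_add_one hs0.le
  have hlow : s < a + 1 := by
    rcases h with h | h
    · rw [h]; exact Nat.lt_floor_add_one s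
    · rw [h]; linarith [Nat.le_ceil s]
  have hk1 : 4 * (2 : ℝ) ^ fullDepth a ≤ a := by exact_mod_cast four_mul_two_pow_fullDepth_le ha
  have hk2 : (a : ℝ) < 8 * 2 ^ fullDepth a := by exact_mod_cast lt_eight_mul_two_pow_fullDepth ha
  have hdiff : Real.log 2 - Real.log (beta d) ≠ 0 := by linarith
  have hvar : (2 : ℝ) ^ fullDepth a / n
      ≤ C4 d σ2 L / 2 * (n : ℝ) ^ (Real.log (beta d) / (Real.log 2 - Real.log (beta d))) := by
    have e : (n : ℝ) ^ (Real.log 2 / (Real.log 2 - Real.log (beta d)))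
        = (n : ℝ) ^ (Real.log (beta d) / (Real.log 2 - Real.log (beta d))) * n := by
      nth_rewrite 3 [← Real.rpow_one (n : ℝ)]
      rw [← Real.rpow_add hn']
      congr 1
      field_simp
      ring
    rw [div_le_iff₀ hn']
    have : s = C4 d σ2 L * ((n : ℝ) ^ (Real.log (beta d) / (Real.log 2 - Real.log (beta d))) * n) := by
      rw [← e]; rfl
    -- From `4 * 2 ^ k ≤ a < s + 1` and `a ≥ 4`, which gives `s > 3` and so `(s + 1) / 4 ≤ s / 2`.
    calc (2 : ℝ) ^ fullDepth a ≤ s / 2 := by linarith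
      _ = _ := by rw [this]; ring
  have hbias : beta d ^ fullDepth a
      ≤ (beta d)⁻¹ ^ 4 * C4 d σ2 L ^ (Real.log (beta d) / Real.log 2)
        * (n : ℝ) ^ (Real.log (beta d) / (Real.log 2 - Real.log (beta d))) := by
    have e1 : s ^ (Real.log (beta d) / Real.log 2)
        = C4 d σ2 L ^ (Real.log (beta d) / Real.log 2)
          * (n : ℝ) ^ (Real.log (beta d) / (Real.log 2 - Real.log (beta d))) := by
      rw [hs, optimalSize, Real.mul_rpow hC4.le (by positivity), ← Real.rpow_mul hn'.le]
      congr 2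
      field_simp
    -- Powers of `β` become powers of `2 ^ k` with a negative exponent, so a lower bound on `2 ^ k`
    -- in terms of `s` is what is needed.
    have e2 : ∀ k : ℕ, beta d ^ k = ((2 : ℝ) ^ k) ^ (Real.log (beta d) / Real.log 2) := by
      intro k
      rw [← Real.rpow_natCast, ← Real.rpow_natCast, ← Real.rpow_mul two_pos.le,
        Real.rpow_def_of_pos hβ, Real.rpow_def_of_pos two_pos]
      congr 1
      field_simp
    -- `s < a + 1 < 8 * 2 ^ k + 1 ≤ 16 * 2 ^ k`; this is the source of the factor `β⁻¹ ^ 4`.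
    have e3 : s ≤ 2 ^ (fullDepth a + 4) := by
      rw [pow_add]; linarith
    have e4 : beta d ^ (fullDepth a + 4) ≤ s ^ (Real.log (beta d) / Real.log 2) := by
      rw [e2]
      exact Real.rpow_le_rpow_of_nonpos hs0 e3 (div_nonpos_of_nonpos_of_nonneg hlβ.le hl2.le)
    rw [mul_assoc, ← e1]
    calc beta d ^ fullDepth a = (beta d)⁻¹ ^ 4 * beta d ^ (fullDepth a + 4) := by
          rw [pow_add]; field_simp
      _ ≤ _ := by gcongr
  rw [riskBound, Real.rpow_natCast, Real.rpow_natCast]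
  have h1 := mul_le_mul_of_nonneg_left hvar (show 0 ≤ 2 * σ2 by linarith)
  have h2 := mul_le_mul_of_nonneg_left hbias (show 0 ≤ (d : ℝ) * (L : ℝ) ^ 2 * C1 d by positivity)
  linarith

end Optimum

end MedianForest

/-! ### Fully grown median forests: assembly -/

theorem corollary2 (d : ℕ) (hd : 0 < d) (σ2 : ℝ) (hσ2 : 0 < σ2) (L : ℝ≥0) (hL : 0 < L) :
    -- the bound on the risk and the size of the leaves, for every fully grown forest
    (∀ (m : EuclideanSpace ℝ (Fin d) → ℝ) (P : Measure (EuclideanSpace ℝ (Fin d) × ℝ)),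
      MedianForest.RegressionModel d σ2 L m P →
      ∀ n a : ℕ, 4 ≤ a → a ≤ n →
        (4 ≤ (a : ℝ) / 2 ^ MedianForest.fullDepth a ∧
          (a : ℝ) / 2 ^ MedianForest.fullDepth a < 8) ∧
        (∀ᵐ D ∂(MedianForest.sampleLaw P n),
          ∀ (θ : MedianForest.TreeParam n d a (MedianForest.fullDepth a)),
            ∀ x ∈ MedianForest.unitCube d,
              3 ≤ (MedianForest.treeLeaf D θ x).card ∧ (MedianForest.treeLeaf D θ x).card ≤ 7) ∧
        ∀ x ∈ MedianForest.unitCube d,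
          MemLp (fun D => MedianForest.forestEstimate a (MedianForest.fullDepth a) D x - m x) 2
            (MedianForest.sampleLaw P n) ∧
          ∫ D, (MedianForest.forestEstimate a (MedianForest.fullDepth a) D x - m x) ^ 2
              ∂(MedianForest.sampleLaw P n)
            ≤ MedianForest.riskBound d σ2 L n (MedianForest.fullDepth a)) ∧
    -- the subsample size that minimises the bound when `k = log₂ a - 2`
    (∀ n : ℕ, 0 < n →
      0 < MedianForest.optimalSize d σ2 L n ∧
      Real.logb 2 (MedianForest.optimalSize d σ2 L n) - 2
        = 1 / (Real.log 2 - Real.log (MedianForest.beta d))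
          * (Real.log n + MedianForest.C3 d σ2 L) ∧
      ∀ a : ℝ, 0 < a → a ≠ MedianForest.optimalSize d σ2 L n →
        MedianForest.riskBound d σ2 L n (Real.logb 2 (MedianForest.optimalSize d σ2 L n) - 2)
          < MedianForest.riskBound d σ2 L n (Real.logb 2 a - 2)) ∧
    -- that size is admissible for all large `n`
    (∀ᶠ n : ℕ in atTop, 4 ≤ ⌊MedianForest.optimalSize d σ2 L n⌋₊ ∧
      ⌈MedianForest.optimalSize d σ2 L n⌉₊ ≤ n) ∧
    -- the rate for that size, rounded down or up
    ∃ C : ℝ, ∀ (m : EuclideanSpace ℝ (Fin d) → ℝ)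
      (P : Measure (EuclideanSpace ℝ (Fin d) × ℝ)),
      MedianForest.RegressionModel d σ2 L m P →
      ∀ n a : ℕ, 4 ≤ a → a ≤ n →
        (a = ⌊MedianForest.optimalSize d σ2 L n⌋₊ ∨ a = ⌈MedianForest.optimalSize d σ2 L n⌉₊) →
        ∀ x ∈ MedianForest.unitCube d,
          ∫ D, (MedianForest.forestEstimate a (MedianForest.fullDepth a) D x - m x) ^ 2
              ∂(MedianForest.sampleLaw P n)
            ≤ C * (n : ℝ) ^ (Real.log (MedianForest.beta d)
                / (Real.log 2 - Real.log (MedianForest.beta d))) := by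
  refine ⟨fun m P h n a ha han => ⟨⟨?_, ?_⟩, ?_, fun x hx => ?_⟩, fun n hn => ⟨?_, ?_, ?_⟩, ?_,
    σ2 * MedianForest.C4 d σ2 L + (d : ℝ) * (L : ℝ) ^ 2 * MedianForest.C1 d
      * ((MedianForest.beta d)⁻¹ ^ 4
        * MedianForest.C4 d σ2 L ^ (Real.log (MedianForest.beta d) / Real.log 2)),
    fun m P h n a ha han hsize x hx => ?_⟩
  · rw [le_div_iff₀ (by positivity)]
    exact_mod_cast MedianForest.four_mul_two_pow_fullDepth_le ha
  · rw [div_lt_iff₀ (by positivity)]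
    exact_mod_cast MedianForest.lt_eight_mul_two_pow_fullDepth ha
  · filter_upwards [h.ae_injective n] with D hD θ x _
    exact MedianForest.card_treeLeaf_mem_Icc hD ha θ x
  · exact h.memLp_and_risk_le hd hσ2.le han (MedianForest.four_mul_two_pow_fullDepth_le ha) hx
  · exact MedianForest.optimalSize_pos d σ2 L hn
  · exact MedianForest.logb_optimalSize d σ2 L hn
  · exact fun a ha hne => MedianForest.riskBound_lt hd hσ2 hL hn ha hne
  · exact MedianForest.eventually_optimalSize hd σ2 L
  · exact ((h.memLp_and_risk_le hd hσ2.le han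
      (MedianForest.four_mul_two_pow_fullDepth_le ha) hx).2).trans
      (MedianForest.riskBound_fullDepth_le hd hσ2 L ha han hsize)
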